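/- Let $\Omega=(-a,a)$ with $a>0$, let $n\ge 1$, and let $K:\Omega\times\Omega\to\mathbb R$ be of class $\mathcal C^{(n,n)}$, i.e. the partial derivatives $K^{(i,j)}=\partial^{i+j}K/\partial x^i\partial y^j$, $0\le i,j\le n$, exist and are continuous on $\Omega\times\Omega$. Let $x_1,\dots,x_n\in\mathbb R$ be distinct, let $\varepsilon_0>0$ be such that $\varepsilon_0x_i\in\Omega$ for all $i$, and suppose that the scaled kernel matrices $\mathbf K_\varepsilon=[K(\varepsilon x_i,\varepsilon x_j)]_{i,j=1}^n$ are symmetric positive semidefinite for $\varepsilon\in[0,\varepsilon_0]$ and that $\varepsilon\mapsto\mathbf K_\varepsilon$ agrees on $[0,\varepsilon_0]$ with a matrix function $\mathbf A(\varepsilon)$ that is real-analytic in a neighborhood of $0$. For $k\ge0$ put $\mathbf V_{\le k}=[x_i^j]_{1\le i\le n,\,0\le j\le k}$ and $\mathbf W_{\le k}=\Big[\frac{K^{(i,j)}(0,0)}{i!\,j!}\Big]_{0\le i,j\le k}$; the matrices $\mathbf W_{\le -1}$ and $\mathbf V_{\le -1}^{T}\mathbf V_{\le -1}$ are empty and have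 determinant $1$. Let $\lambda_1(\varepsilon)\ge\dots\ge\lambda_n(\varepsilon)$ be the ordered eigenvalues. An *analytic eigenvalue decomposition* is $\mathbf A(\varepsilon)=\sum_{k=1}^n\lambda_k(\varepsilon)\mathbf P_k(\varepsilon)$ for $\varepsilon$ near $0$, with $\lambda_k$ and mutually orthogonal rank-one orthogonal projectors $\mathbf P_k$ analytic at $0$, and $\lambda_1\ge\dots\ge\lambda_n$ for small $\varepsilon>0$. We say that $\widetilde\lambda_s$ is the main term of $\lambda_s$ if $\lambda_s(\varepsilon)=\varepsilon^{2(s-1)}(\widetilde\lambda_s+O(\varepsilon))$, both as $\varepsilon\to0^+$ for the ordered eigenvalue and as $\varepsilon\to0$ for the $s$-th branch of every analytic eigenvalue decomposition. We say that $p$ is the $s$-th limiting eigenvector (up to sign) if $\mathbf P_s(0)=pp^{T}$ for every analytic eigenvalue decomposition and, moreover, $u(\varepsilon)u(\varepsilon)^{T}\to pp^{T}$ as $\varepsilon\to0^+$ for every choice of unit eigenvectors $u(\varepsilon)$ of $\mathbf K_\varepsilon$ belonging to $\lambda_s(\varepsilon)$. A full QR factorization of an $n\times m$ matrix $\mathbf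 V$ is $\mathbf V=\mathbf Q\mathbf R$ with $\mathbf Q\in\mathbb R^{n\times n}$ orthogonal and $\mathbf R\in\mathbb R^{n\times m}$ upper triangular. Then: 1. If $1\le s\le n$ and $\det\mathbf W_{\le s-2}\ne0$, the main term of the $s$-th eigenvalue is $$\widetilde\lambda_s=\frac{\det(\mathbf V_{\le s-1}^{T}\mathbf V_{\le s-1})}{\det(\mathbf V_{\le s-2}^{T}\mathbf V_{\le s-2})}\cdot\frac{\det\mathbf W_{\le s-1}}{\det\mathbf W_{\le s-2}}.\qquad(*)$$ 2. If $1\le s<n$ and $\det\mathbf W_{\le s-1}\ne0$, then for every full QR factorization $\mathbf V_{\le s-1}=\mathbf Q\mathbf R$ the first $s$ limiting eigenvectors are, up to sign, the first $s$ columns of $\mathbf Q$. These columns are discrete orthogonal polynomials: there are polynomials $\varphi_0,\dots,\varphi_{s-1}$ with $\deg\varphi_k=k$ and $\sum_i\varphi_k(x_i)\varphi_l(x_i)=\delta_{kl}$ such that the $(k+1)$-st column is $(\varphi_k(x_1),\dots,\varphi_k(x_n))^{T}$ for $0\le k<s$. 3. In particular, if $\det\mathbf W_{\le n-2}\ne0$,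 then the main terms of all eigenvalues are given by $(*)$, and for every QR factorization $\mathbf V_{\le n-1}=\mathbf Q\mathbf R$ all the limiting eigenvectors are, up to sign, the columns of $\mathbf Q$, which are discrete orthonormal polynomials of degrees $0,\dots,n-1$ evaluated at the points, as in 2. -/

import Mathlib

open Filter Topology Asymptotics Matrix

noncomputable section

namespace FlatLimit

/-- The partial derivative `∂^(i+j) K / ∂x^i ∂y^j` at `(x, y)`. -/
def pderiv (K : ℝ → ℝ → ℝ) (i j : ℕ) (x y : ℝ) : ℝ :=
  iteratedDeriv i (fun x' => iteratedDeriv j (K x') y) x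

/-- `K` is of class `C^(ℓ,ℓ)` on `(-a, a) × (-a, a)`: the partial derivatives
`∂^(i+j) K / ∂x^i ∂y^j`, `0 ≤ i, j ≤ ℓ`, exist (first `j` derivatives in `y`, then `i` in `x`)
and are continuous there. Since `(-a, a)` is open, only the values of `K` on
`(-a, a) × (-a, a)` matter. -/
structure IsMixedCk (K : ℝ → ℝ → ℝ) (a : ℝ) (ℓ : ℕ) : Prop where
  diff_y : ∀ j < ℓ, ∀ x ∈ Set.Ioo (-a) a, ∀ y ∈ Set.Ioo (-a) a,
    DifferentiableAt ℝ (fun y' => pderiv K 0 j x y') y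
  diff_x : ∀ i < ℓ, ∀ j ≤ ℓ, ∀ x ∈ Set.Ioo (-a) a, ∀ y ∈ Set.Ioo (-a) a,
    DifferentiableAt ℝ (fun x' => pderiv K i j x' y) x
  cont : ∀ i ≤ ℓ, ∀ j ≤ ℓ, ContinuousOn (fun z : ℝ × ℝ => pderiv K i j z.1 z.2)
    (Set.Ioo (-a) a ×ˢ Set.Ioo (-a) a)

/-- The `m × m` Wronskian matrix `W_{≤ m-1}` of `K` (degrees `0, …, m-1`). -/
def wronskian (K : ℝ → ℝ → ℝ) (m : ℕ) : Matrix (Fin m) (Fin m) ℝ :=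
  Matrix.of fun i j =>
    pderiv K i j 0 0 / ((Nat.factorial (i : ℕ) : ℝ) * (Nat.factorial (j : ℕ) : ℝ))

/-- The `n × m` Vandermonde matrix `V_{≤ m-1}` of the points (degrees `0, …, m-1`). -/
def vander {n : ℕ} (x : Fin n → ℝ) (m : ℕ) : Matrix (Fin n) (Fin m) ℝ :=
  Matrix.of fun i j => x i ^ (j : ℕ)

/-- The scaled kernel matrix `K_ε = [K(ε x_i, ε x_j)]`. -/
def kernelMatrix {n : ℕ} (K : ℝ → ℝ → ℝ) (x : Fin n → ℝ) (ε : ℝ) : Matrix (Fin n) (Fin n) ℝ :=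
  Matrix.of fun i j => K (ε * x i) (ε * x j)

/-- The eigenvalues of a symmetric matrix, with multiplicity, in nonincreasing order
(numbered from `0`); the value is `0` for a matrix that is not symmetric. -/
def sortedEigenvalue {n : ℕ} (M : Matrix (Fin n) (Fin n) ℝ) (k : Fin n) : ℝ :=
  open Classical in
  if h : M.IsHermitian then h.eigenvalues₀ (Fin.cast (Fintype.card_fin n).symm k) else 0

/-- An analytic eigenvalue decomposition `A(ε) = ∑ λ_k(ε) P_k(ε)` in a neighbourhood of `0`:
the `λ_k` and the mutually orthogonal rank-one orthogonal projectors `P_k` are analytic at `0`,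
and the `λ_k` are numbered in nonincreasing order for small `ε > 0`. -/
structure IsAnalyticEVD {n : ℕ} (A : ℝ → Matrix (Fin n) (Fin n) ℝ)
    (lam : Fin n → ℝ → ℝ) (P : Fin n → ℝ → Matrix (Fin n) (Fin n) ℝ) : Prop where
  analytic_lam : ∀ k, AnalyticAt ℝ (lam k) 0
  analytic_P : ∀ k i j, AnalyticAt ℝ (fun ε => P k ε i j) 0
  symm : ∀ᶠ ε in 𝓝 (0 : ℝ), ∀ k, (P k ε)ᵀ = P k ε
  orth : ∀ᶠ ε in 𝓝 (0 : ℝ), ∀ k l, P k ε * P l ε = if k = l then P k ε else 0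
  rank_one : ∀ᶠ ε in 𝓝 (0 : ℝ), ∀ k, (P k ε).rank = 1
  sum_eq : ∀ᶠ ε in 𝓝 (0 : ℝ), A ε = ∑ k, lam k ε • P k ε
  ordered : ∀ᶠ ε in 𝓝[>] (0 : ℝ), Antitone fun k => lam k ε

/-- `f(ε) = ε^m (c + O(ε))` along the filter `l`. -/
def HasMainTerm (l : Filter ℝ) (f : ℝ → ℝ) (m : ℕ) (c : ℝ) : Prop :=
  (fun ε => f ε - ε ^ m * c) =O[l] fun ε => ε ^ (m + 1)

/-- `c` is the coefficient of `ε^(2k)` in the expansion `λ(ε) = ε^(2k) (c + O(ε))` of the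
eigenvalue number `k` (numbered from `0`) of `A(ε)`, both as `ε → 0+` for the ordered eigenvalue
and as `ε → 0` for the corresponding branch of every analytic eigenvalue decomposition. -/
def IsEigenvalueMainTerm {n : ℕ} (A : ℝ → Matrix (Fin n) (Fin n) ℝ) (k : Fin n) (c : ℝ) : Prop :=
  HasMainTerm (𝓝[>] 0) (fun ε => sortedEigenvalue (A ε) k) (2 * (k : ℕ)) c ∧
  ∀ lam P, IsAnalyticEVD A lam P → HasMainTerm (𝓝 0) (lam k) (2 * (k : ℕ)) c

/-- `p` is (up to sign) the limiting eigenvector number `k` (numbered from `0`) of `A(ε)`: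
`P_k(0) = p pᵀ` for every analytic eigenvalue decomposition, and moreover `u(ε) u(ε)ᵀ → p pᵀ` as
`ε → 0+` for every choice of unit eigenvectors `u(ε)` to the `k`-th ordered eigenvalue. -/
def IsLimitingEigenvector {n : ℕ} (A : ℝ → Matrix (Fin n) (Fin n) ℝ) (k : Fin n)
    (p : Fin n → ℝ) : Prop :=
  (∀ lam P, IsAnalyticEVD A lam P → P k 0 = vecMulVec p p) ∧
  ∀ u : ℝ → Fin n → ℝ,
    (∀ᶠ ε in 𝓝[>] (0 : ℝ), u ε ⬝ᵥ u ε = 1 ∧ A ε *ᵥ u ε = sortedEigenvalue (A ε) k • u ε) →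
    Tendsto (fun ε => vecMulVec (u ε) (u ε)) (𝓝[>] 0) (𝓝 (vecMulVec p p))

/-- `V = Q R` is a full QR factorization: `Q` is an `n × n` orthogonal matrix and the `n × m`
matrix `R` is upper triangular (its rows after the `m`-th are zero). -/
structure IsFullQR {n m : ℕ} (V : Matrix (Fin n) (Fin m) ℝ) (Q : Matrix (Fin n) (Fin n) ℝ)
    (R : Matrix (Fin n) (Fin m) ℝ) : Prop where
  orth : Qᵀ * Q = 1
  upper : ∀ (i : Fin n) (j : Fin m), (j : ℕ) < (i : ℕ) → R i j = 0
  eq : V = Q * R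

/-- `φ 0, …, φ (m-1)` are orthonormal polynomials, `φ k` of degree exactly `k`, for the discrete
inner product `∑ i, p(x_i) q(x_i)`. -/
def IsDiscreteOrthonormal {n : ℕ} (x : Fin n → ℝ) (m : ℕ) (φ : ℕ → Polynomial ℝ) : Prop :=
  (∀ k < m, (φ k).degree = k) ∧
  ∀ k < m, ∀ l < m, ∑ i, (φ k).eval (x i) * (φ l).eval (x i) = if k = l then 1 else 0

end FlatLimit

end

namespace FlatLimit

/-! ### Taylor expansions -/

/-! Pass to the basis formed by the columns `q_i` of `Q`. Since `Qᵀ V = R` is upper triangular,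
`q_i` annihilates the monomials of degree less than `i` on the points. Taylor expansion in each
variable then shows that entry `(i, j)` of `Qᵀ A(ε) Q` is `ε^(i+j) B(ε)_{ij}` with `B` analytic and
`B(0)_{ij} = R_{ii} R_{jj} W_{ij}` (`tendsto_kernel_form`, `exists_grading`). Hence the leading `m ×
m` minor of `B(0)` is `det(VᵀV) det W` for the degrees below `m`, and `(*)` becomes a quotient of
consecutive leading minors.

The rest is spectral asymptotics of graded matrices (`IsGraded`), with `k = s - 1`. A min-max
argument gives `λ_k = O(ε^(2k))`, and a dual one gives `ε^(2k) = O(λ_k)` if the minor of order `k +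
1` is nonzero. If the minor `d` of order `k` is nonzero, the eigenvector equation forces `λ_k u_i =
O(ε^(2k+1))` for `i ≠ k`. Cramer's rule on the leading block of order `k + 1`, with determinant
`d'`, gives `(d' ε^(2k) - d λ_k) u_k = O(ε^(2k+1))` (`det_relation`). Together these give the main
term `d' / d`; when `d' ≠ 0` or `k` is the last index, they also show that every coordinate of `u`
but the `k`-th tends to zero.

Estimates are made for `ε > 0` and for any ordered list of eigenvalues (`HasOrderedSpectrum`), so
they cover the sorted eigenvalues and the analytic branches alike; analyticity carries the latter
over to a full neighbourhood. Positive semidefiniteness passes to the leading blocks of `B(0)`, so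
one nonzero Wronskian determinant forces all smaller ones to be nonzero. -/

theorem abs_sub_taylor_le {a δ η c : ℝ} (hδ : δ < a) (j : ℕ) : ∀ F : ℕ → ℝ → ℝ,
    (∀ m < j, ∀ t ∈ Set.Ioo (-a) a, HasDerivAt (F m) (F (m + 1) t) t) →
    (∀ t, |t| ≤ δ → |F j t - c| ≤ η) → ∀ t, |t| ≤ δ →
    |F 0 t - (∑ b ∈ Finset.range j, F b 0 / (b.factorial : ℝ) * t ^ b
      + c / (j.factorial : ℝ) * t ^ j)| ≤ η * |t| ^ j := by
  induction j with
  | zero => intro F _ h t ht; simpa using h t ht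
  | succ j ih =>
    intro F hF h t ht
    -- The induction hypothesis for the shifted family bounds the derivative of the remainder; the
    -- mean value inequality from `0` to `t` then gains a factor `|t|`.
    have key := ih (fun m => F (m + 1)) (fun m hm s hs => hF (m + 1) (by omega) s hs) h
    set g : ℝ → ℝ := fun s => F 0 s - (∑ b ∈ Finset.range (j + 1), F b 0 / (b.factorial : ℝ) * s ^ b
      + c / ((j + 1).factorial : ℝ) * s ^ (j + 1)) with hg
    have hcoef : ∀ (d s : ℝ) (b : ℕ), HasDerivAt (fun s : ℝ => d / ((b + 1).factorial : ℝ)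
        * s ^ (b + 1)) (d / (b.factorial : ℝ) * s ^ b) s := by
      intro d s b
      have h1 := (hasDerivAt_pow (b + 1) s).const_mul (d / ((b + 1).factorial : ℝ))
      refine h1.congr_deriv ?_
      have : (b.factorial : ℝ) ≠ 0 := by positivity
      rw [Nat.factorial_succ]
      push_cast
      have : (b : ℝ) + 1 ≠ 0 := by positivity
      field_simp
    have hη : 0 ≤ η := (abs_nonneg _).trans (h t ht)
    have hgd : ∀ s, |s| ≤ |t| → HasDerivAt g (F 1 s - (∑ b ∈ Finset.range j,
        F (b + 1) 0 / (b.factorial : ℝ) * s ^ b + c / (j.factorial : ℝ) * s ^ j)) s := by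
      intro s hs
      have hsI : s ∈ Set.Ioo (-a) a := abs_lt.1 ((hs.trans ht).trans_lt hδ)
      have h2 : HasDerivAt (fun s => ∑ b ∈ Finset.range (j + 1), F b 0 / (b.factorial : ℝ) * s ^ b)
          (∑ b ∈ Finset.range j, F (b + 1) 0 / (b.factorial : ℝ) * s ^ b) s := by
        simp only [Finset.sum_range_succ', pow_zero, mul_one]
        exact (HasDerivAt.fun_sum fun b _ => hcoef _ s b).add_const _
      exact (hF 0 (by omega) s hsI).sub (h2.add (hcoef c s j))
    have hbd := (convex_Icc (-|t|) |t|).norm_image_sub_le_of_norm_hasDerivWithin_le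
      (f := g) (C := η * |t| ^ j) (x := 0) (y := t)
      (fun s hs => (hgd s (abs_le.2 hs)).hasDerivWithinAt)
      (fun s hs => by
        have hs' := abs_le.2 hs
        refine (key s (hs'.trans ht)).trans ?_
        gcongr)
      ⟨by simp, abs_nonneg t⟩ (abs_le.1 le_rfl)
    have hg0 : g 0 = 0 := by
      simp [hg, Finset.sum_range_succ']
    rw [hg0, sub_zero, sub_zero, Real.norm_eq_abs, Real.norm_eq_abs] at hbd
    calc |g t| ≤ η * |t| ^ j * |t| := hbd
      _ = η * |t| ^ (j + 1) := by ring

/-- A functional that kills all degrees below `j` sees only the top Taylor term and the remainder.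
The top derivative need only be close to a constant `c`, which lets the estimate be applied once in
each variable. -/
theorem abs_functional_sub_le {n : ℕ} {x q : Fin n → ℝ} {a δ η c ε : ℝ} (hδ : δ < a) {j : ℕ}
    (hq : ∀ b < j, ∑ k, q k * x k ^ b = 0) (hε : 0 ≤ ε) (hx : ∀ k, |ε * x k| ≤ δ)
    (F : ℕ → ℝ → ℝ)
    (hF : ∀ m < j, ∀ t ∈ Set.Ioo (-a) a, HasDerivAt (F m) (F (m + 1) t) t)
    (hc : ∀ t, |t| ≤ δ → |F j t - c| ≤ η) :
    |∑ k, q k * F 0 (ε * x k) - ε ^ j * ((∑ k, q k * x k ^ j) * (c / (j.factorial : ℝ)))|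
      ≤ η * (ε ^ j * ∑ k, |q k| * |x k| ^ j) := by
  have h1 : ∑ k, q k * F 0 (ε * x k) - ε ^ j * ((∑ k, q k * x k ^ j) * (c / (j.factorial : ℝ)))
      = ∑ k, q k * (F 0 (ε * x k) - (∑ b ∈ Finset.range j,
        F b 0 / (b.factorial : ℝ) * (ε * x k) ^ b + c / (j.factorial : ℝ) * (ε * x k) ^ j)) := by
    simp only [mul_sub, mul_add, Finset.sum_sub_distrib, Finset.sum_add_distrib]
    have h2 : ∑ k, q k * ∑ b ∈ Finset.range j, F b 0 / (b.factorial : ℝ) * (ε * x k) ^ b = 0 := by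
      simp only [Finset.mul_sum]
      rw [Finset.sum_comm]
      refine Finset.sum_eq_zero fun b hb => ?_
      have := hq b (Finset.mem_range.1 hb)
      calc ∑ k, q k * (F b 0 / (b.factorial : ℝ) * (ε * x k) ^ b)
          = F b 0 / (b.factorial : ℝ) * ε ^ b * ∑ k, q k * x k ^ b := by
            rw [Finset.mul_sum]; exact Finset.sum_congr rfl fun k _ => by ring
        _ = 0 := by rw [this, mul_zero]
    rw [h2, zero_add, Finset.sum_mul, Finset.mul_sum]
    congr 1
    exact Finset.sum_congr rfl fun k _ => by ring
  rw [h1, Finset.mul_sum, Finset.mul_sum]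
  refine (Finset.abs_sum_le_sum_abs _ _).trans (Finset.sum_le_sum fun k _ => ?_)
  rw [abs_mul]
  have h3 := abs_sub_taylor_le hδ j F hF hc (ε * x k) (hx k)
  calc _ ≤ |q k| * (η * |ε * x k| ^ j) := by gcongr
    _ = η * (ε ^ j * (|q k| * |x k| ^ j)) := by rw [abs_mul, abs_of_nonneg hε]; ring

theorem IsMixedCk.hasDerivAt_left {K : ℝ → ℝ → ℝ} {a : ℝ} {ℓ : ℕ} (hK : IsMixedCk K a ℓ)
    {i j : ℕ} (hi : i < ℓ) (hj : j ≤ ℓ) {x y : ℝ} (hx : x ∈ Set.Ioo (-a) a)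
    (hy : y ∈ Set.Ioo (-a) a) :
    HasDerivAt (fun x' => pderiv K i j x' y) (pderiv K (i + 1) j x y) x := by
  refine (hK.diff_x i hi j hj x hx y hy).hasDerivAt.congr_deriv ?_
  unfold pderiv
  rw [iteratedDeriv_succ]

theorem IsMixedCk.hasDerivAt_right {K : ℝ → ℝ → ℝ} {a : ℝ} {ℓ : ℕ} (hK : IsMixedCk K a ℓ)
    {j : ℕ} (hj : j < ℓ) {x y : ℝ} (hx : x ∈ Set.Ioo (-a) a) (hy : y ∈ Set.Ioo (-a) a) :
    HasDerivAt (fun y' => pderiv K 0 j x y') (pderiv K 0 (j + 1) x y) y := by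
  refine (hK.diff_y j hj x hx y hy).hasDerivAt.congr_deriv ?_
  simp only [pderiv, iteratedDeriv_zero]
  rw [iteratedDeriv_succ]

/-- The leading term of a bilinear form in the scaled kernel, for two functionals that annihilate
the polynomials of degree less than `i` and `j`. -/
theorem tendsto_kernel_form {n ℓ : ℕ} {K : ℝ → ℝ → ℝ} {a : ℝ} (ha : 0 < a)
    (hK : IsMixedCk K a ℓ) {i j : ℕ} (hi : i ≤ ℓ) (hj : j ≤ ℓ) {x p q : Fin n → ℝ}
    (hp : ∀ b < i, ∑ k, p k * x k ^ b = 0) (hq : ∀ b < j, ∑ k, q k * x k ^ b = 0) :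
    Tendsto (fun ε => (∑ k, ∑ l, p k * q l * K (ε * x k) (ε * x l)) / ε ^ (i + j)) (𝓝[>] 0)
      (𝓝 ((∑ k, p k * x k ^ i) * (∑ k, q k * x k ^ j) *
        (pderiv K i j 0 0 / ((i.factorial : ℝ) * (j.factorial : ℝ))))) := by
  set C : ℝ := ∑ k, |p k| * |x k| ^ i
  set D : ℝ := ∑ k, |q k| * |x k| ^ j
  have hC : 0 ≤ C := Finset.sum_nonneg fun k _ => by positivity
  have hD : 0 ≤ D := Finset.sum_nonneg fun k _ => by positivity
  set κ := pderiv K i j 0 0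
  rw [Metric.tendsto_nhds]
  intro e he
  -- Chosen so that `η * (C * D) < e`; the `+ 1` covers `C * D = 0`.
  set η := e / (2 * (C * D + 1)) with hη
  have hη0 : 0 < η := by positivity
  have h0 : (0 : ℝ) ∈ Set.Ioo (-a) a := ⟨by linarith, ha⟩
  have hcont : ContinuousAt (fun z : ℝ × ℝ => pderiv K i j z.1 z.2) (0, 0) :=
    (hK.cont i hi j hj).continuousAt (((isOpen_Ioo).prod isOpen_Ioo).mem_nhds ⟨h0, h0⟩)
  obtain ⟨δ₀, hδ₀, hδ⟩ := Metric.continuousAt_iff.1 hcont η hη0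
  set δ := min (δ₀ / 2) (a / 2) with hδdef
  have hδpos : 0 < δ := by positivity
  have hδa : δ < a := (min_le_right _ _).trans_lt (by linarith)
  have hδ0 : δ < δ₀ := (min_le_left _ _).trans_lt (by linarith)
  have hmem : ∀ t, |t| ≤ δ → t ∈ Set.Ioo (-a) a := fun t ht => abs_lt.1 (ht.trans_lt hδa)
  have hclose : ∀ s t, |s| ≤ δ → |t| ≤ δ → |pderiv K i j s t - κ| ≤ η := by
    intro s t hs ht
    have := hδ (x := (s, t)) (by
      rw [Prod.dist_eq, Real.dist_eq, Real.dist_eq, sub_zero, sub_zero]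
      exact max_lt (hs.trans_lt hδ0) (ht.trans_lt hδ0))
    rw [Real.dist_eq] at this
    exact this.le
  have hsmall : ∀ᶠ ε in 𝓝[>] (0 : ℝ), ∀ k, |ε * x k| ≤ δ := by
    rw [eventually_all]
    intro k
    have : Tendsto (fun ε : ℝ => |ε * x k|) (𝓝[>] 0) (𝓝 0) := by
      have : Continuous fun ε : ℝ => |ε * x k| := by fun_prop
      simpa using (this.tendsto 0).mono_left nhdsWithin_le_nhds
    exact (this.eventually (gt_mem_nhds hδpos)).mono fun _ h => h.le
  filter_upwards [hsmall, self_mem_nhdsWithin] with ε hsm hε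
  have hε0 : 0 < ε := hε
  -- Apply the functional `p` in the first variable to `∂_y^j K`, with `y` frozen and uniformly in
  -- `y`.
  have step1 : ∀ y, |y| ≤ δ → |∑ k, p k * pderiv K 0 j (ε * x k) y
      - ε ^ i * ((∑ k, p k * x k ^ i) * (κ / (i.factorial : ℝ)))| ≤ η * (ε ^ i * C) := by
    intro y hy
    exact abs_functional_sub_le hδa hp hε0.le hsm (fun m s => pderiv K m j s y)
      (fun m hm s hs => hK.hasDerivAt_left (by omega) hj hs (hmem y hy))
      (fun s hs => hclose s y hs hy)
  -- Apply `q` in the second variable to `y ↦ ∑ p_k K(ε x_k, y)`; `step1` says that its `j`-th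
  -- derivative is nearly constant, with tolerance `η * (ε ^ i * C)`.
  have step2 := abs_functional_sub_le hδa hq hε0.le hsm
    (fun m y => ∑ k, p k * pderiv K 0 m (ε * x k) y)
    (fun m hm y hy => HasDerivAt.fun_sum fun k _ =>
      (hK.hasDerivAt_right (by omega) (hmem _ (hsm k)) hy).const_mul _) step1
  have e1 : ∑ l, q l * ∑ k, p k * pderiv K 0 0 (ε * x k) (ε * x l)
      = ∑ k, ∑ l, p k * q l * K (ε * x k) (ε * x l) := by
    simp only [Finset.mul_sum]
    rw [Finset.sum_comm]
    refine Finset.sum_congr rfl fun k _ => Finset.sum_congr rfl fun l _ => ?_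
    simp only [pderiv, iteratedDeriv_zero]
    ring
  simp only [e1] at step2
  rw [Real.dist_eq]
  have hpow : 0 < ε ^ (i + j) := by positivity
  have e2 : ∀ S : ℝ, S / ε ^ (i + j) - (∑ k, p k * x k ^ i) * (∑ k, q k * x k ^ j) *
      (κ / ((i.factorial : ℝ) * (j.factorial : ℝ))) = (S - ε ^ j * ((∑ k, q k * x k ^ j) *
      (ε ^ i * ((∑ k, p k * x k ^ i) * (κ / (i.factorial : ℝ))) / (j.factorial : ℝ))))
        / ε ^ (i + j) := by
    intro S
    have h1 : (i.factorial : ℝ) ≠ 0 := by positivity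
    have h2 : (j.factorial : ℝ) ≠ 0 := by positivity
    rw [pow_add]
    field_simp
  rw [e2, abs_div, abs_of_pos hpow, div_lt_iff₀ hpow]
  refine step2.trans_lt ?_
  have : η * (C * D) < e := by
    rw [hη, div_mul_eq_mul_div, div_lt_iff₀ (by positivity)]
    nlinarith [mul_nonneg hC hD]
  calc η * (ε ^ i * C) * (ε ^ j * D) = η * (C * D) * ε ^ (i + j) := by rw [pow_add]; ring
    _ < e * ε ^ (i + j) := by gcongr

/-! ### One-sided estimates of analytic functions -/

/-- If the order of vanishing were `p < m`, dividing by `ε ^ p` would leave a factor that is nonzero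
at `0` yet tends to `0` from the right. So a one-sided bound already determines the order at `0`. -/
theorem exists_analytic_factor {f : ℝ → ℝ} (hf : AnalyticAt ℝ f 0) {m : ℕ}
    (hO : f =O[𝓝[>] 0] fun ε => ε ^ m) :
    ∃ g : ℝ → ℝ, AnalyticAt ℝ g 0 ∧ ∀ᶠ ε in 𝓝 (0 : ℝ), f ε = ε ^ m * g ε := by
  have hle : (m : ℕ∞) ≤ analyticOrderAt f 0 := by
    by_contra! hlt
    obtain ⟨p, hp⟩ := ENat.ne_top_iff_exists.1 (ne_top_of_lt hlt)
    rw [← hp] at hlt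
    have hpm : p < m := by exact_mod_cast hlt
    obtain ⟨g, hg, hg0, hfg⟩ := (hf.analyticOrderAt_eq_natCast).1 hp.symm
    have hgO : g =O[𝓝[>] 0] fun ε : ℝ => ε ^ (m - p) := by
      obtain ⟨c, hc⟩ := hO.bound
      refine IsBigO.of_bound c ?_
      filter_upwards [hc, hfg.filter_mono nhdsWithin_le_nhds, self_mem_nhdsWithin] with ε h1 h2 h3
      have h3' : (0 : ℝ) < ε := h3
      have hpp : 0 < ‖ε ^ p‖ := norm_pos_iff.2 (pow_pos h3' p).ne'
      rw [h2, sub_zero, smul_eq_mul, norm_mul, show m = p + (m - p) by omega, pow_add,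
        norm_mul] at h1
      nlinarith [h1]
    have ht : Tendsto g (𝓝[>] 0) (𝓝 0) := by
      refine hgO.trans_tendsto ?_
      have : Continuous fun ε : ℝ => ε ^ (m - p) := by fun_prop
      simpa [show m - p ≠ 0 by omega] using (this.tendsto 0).mono_left nhdsWithin_le_nhds
    exact hg0 (tendsto_nhds_unique (hg.continuousAt.tendsto.mono_left nhdsWithin_le_nhds) ht)
  obtain ⟨g, hg, h⟩ := (natCast_le_analyticOrderAt hf).1 hle
  exact ⟨g, hg, by simpa using h⟩

theorem exists_analytic_factor_of_tendsto {f : ℝ → ℝ} (hf : AnalyticAt ℝ f 0) {m : ℕ} {L : ℝ}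
    (hL : Tendsto (fun ε => f ε / ε ^ m) (𝓝[>] 0) (𝓝 L)) :
    ∃ g : ℝ → ℝ, AnalyticAt ℝ g 0 ∧ (∀ᶠ ε in 𝓝 (0 : ℝ), f ε = ε ^ m * g ε) ∧ g 0 = L := by
  have hne : ∀ᶠ ε in 𝓝[>] (0 : ℝ), ε ^ m ≠ 0 := by
    filter_upwards [self_mem_nhdsWithin] with ε hε
    exact pow_ne_zero _ (ne_of_gt hε)
  obtain ⟨g, hg, h⟩ := exists_analytic_factor hf (m := m)
    ((isBigO_of_div_tendsto_nhds (hne.mono fun ε h1 h2 => absurd h2 h1) L hL))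
  refine ⟨g, hg, h, tendsto_nhds_unique
    (hg.continuousAt.tendsto.mono_left nhdsWithin_le_nhds) (hL.congr' ?_)⟩
  filter_upwards [hne, h.filter_mono nhdsWithin_le_nhds] with ε h1 h2
  rw [h2, mul_div_cancel_left₀ _ h1]

theorem isBigO_nhds_of_isBigO_right {f : ℝ → ℝ} (hf : AnalyticAt ℝ f 0) {m : ℕ}
    (hO : f =O[𝓝[>] 0] fun ε => ε ^ m) : f =O[𝓝 0] fun ε => ε ^ m := by
  obtain ⟨g, hg, h⟩ := exists_analytic_factor hf hO
  have h1 : (fun ε => ε ^ m * g ε) =O[𝓝 0] fun ε : ℝ => ε ^ m * (1 : ℝ) :=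
    (isBigO_refl _ _).mul (hg.continuousAt.tendsto.isBigO_one ℝ)
  simpa using h1.congr' (h.mono fun _ h => h.symm) EventuallyEq.rfl

end FlatLimit

namespace FlatLimit

/-! ### Ordered spectral decompositions -/

/-- `lam` lists the eigenvalues of `M` in nonincreasing order, with an orthonormal eigenbasis. -/
def HasOrderedSpectrum {n : ℕ} (M : Matrix (Fin n) (Fin n) ℝ) (lam : Fin n → ℝ) : Prop :=
  Antitone lam ∧ ∃ U : Matrix (Fin n) (Fin n) ℝ, Uᵀ * U = 1 ∧ M * U = U * diagonal lam

theorem dotProduct_mulVec_mulVec {n : ℕ} (U V : Matrix (Fin n) (Fin n) ℝ) (c d : Fin n → ℝ) :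
    (U *ᵥ c) ⬝ᵥ (V *ᵥ d) = c ⬝ᵥ ((Uᵀ * V) *ᵥ d) := by
  rw [← mulVec_mulVec, dotProduct_mulVec c, vecMul_transpose]

theorem HasOrderedSpectrum.conj {n : ℕ} {M Q : Matrix (Fin n) (Fin n) ℝ} {lam : Fin n → ℝ}
    (h : HasOrderedSpectrum M lam) (hQ : Qᵀ * Q = 1) : HasOrderedSpectrum (Qᵀ * M * Q) lam := by
  obtain ⟨hanti, U, hU, hMU⟩ := h
  have hQ' : Q * Qᵀ = 1 := mul_eq_one_comm.1 hQ
  refine ⟨hanti, Qᵀ * U, ?_, ?_⟩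
  · rw [transpose_mul, transpose_transpose, Matrix.mul_assoc, ← Matrix.mul_assoc Q, hQ',
      Matrix.one_mul, hU]
  · rw [Matrix.mul_assoc _ Q, ← Matrix.mul_assoc Q, hQ', Matrix.one_mul, Matrix.mul_assoc, hMU,
      Matrix.mul_assoc]

theorem HasOrderedSpectrum.nonneg {n : ℕ} {M : Matrix (Fin n) (Fin n) ℝ} {lam : Fin n → ℝ}
    (h : HasOrderedSpectrum M lam) (hM : M.PosSemidef) (k : Fin n) : 0 ≤ lam k := by
  obtain ⟨-, U, hU, hMU⟩ := h
  have h1 := hM.dotProduct_mulVec_nonneg (U *ᵥ Pi.single k 1)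
  rw [star_trivial, mulVec_mulVec, hMU, dotProduct_mulVec_mulVec, ← Matrix.mul_assoc, hU,
    Matrix.one_mul] at h1
  simpa using h1

/-- Dimension count for the min-max arguments: `n - 1` linear conditions on `n` unknowns. Some rows
will impose vanishing of spectral coefficients, the others vanishing of coordinates. -/
theorem exists_ne_zero_mulVec_eq_zero {n : ℕ} (N : Matrix (Fin n) (Fin n) ℝ) (k : Fin n) :
    ∃ c ≠ 0, ∀ i ≠ k, (N *ᵥ c) i = 0 := by
  have hdet : (N.updateRow k 0).det = 0 := det_eq_zero_of_row_eq_zero k fun j => by simp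
  obtain ⟨c, hc, h⟩ := exists_mulVec_eq_zero_iff.2 hdet
  refine ⟨c, hc, fun i hi => ?_⟩
  have := congrFun h i
  simpa [mulVec, updateRow_ne hi] using this

/-- Courant–Fischer: some nonzero combination `y` of the eigenvectors with index at most `k`
vanishes in all coordinates before `k`. Its Rayleigh quotient is at least `lam k` and involves only
the trailing block. -/
theorem HasOrderedSpectrum.le_of_entries {n : ℕ} {M : Matrix (Fin n) (Fin n) ℝ} {lam : Fin n → ℝ}
    (h : HasOrderedSpectrum M lam) (k : Fin n) {D : ℝ}
    (hD : ∀ i j, k ≤ i → k ≤ j → |M i j| ≤ D) : lam k ≤ n * D := by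
  obtain ⟨hanti, U, hU, hMU⟩ := h
  obtain ⟨c, hc, hcz⟩ := exists_ne_zero_mulVec_eq_zero
    (Matrix.of fun i j => if i < k then U i j else (1 : Matrix (Fin n) (Fin n) ℝ) i j) k
  have hc1 : ∀ i, k < i → c i = 0 := by
    intro i hi
    have := hcz i hi.ne'
    simpa [mulVec, dotProduct, not_lt.2 hi.le, one_apply] using this
  have hy1 : ∀ i, i < k → (U *ᵥ c) i = 0 := by
    intro i hi
    have := hcz i hi.ne
    simpa [mulVec, dotProduct, hi] using this
  set y := U *ᵥ c with hy
  have hyy : y ⬝ᵥ y = c ⬝ᵥ c := by rw [hy, dotProduct_mulVec_mulVec, hU, one_mulVec]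
  have hyM : y ⬝ᵥ (M *ᵥ y) = ∑ m, lam m * c m ^ 2 := by
    rw [hy, mulVec_mulVec, hMU, dotProduct_mulVec_mulVec, ← Matrix.mul_assoc, hU, Matrix.one_mul]
    simp only [dotProduct, mulVec_diagonal]
    exact Finset.sum_congr rfl fun m _ => by ring
  have hcpos : 0 < c ⬝ᵥ c := lt_of_le_of_ne
    (Finset.sum_nonneg fun i _ => mul_self_nonneg _) (Ne.symm (by simpa using hc))
  have hlow : lam k * (c ⬝ᵥ c) ≤ y ⬝ᵥ (M *ᵥ y) := by
    rw [hyM, dotProduct, Finset.mul_sum]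
    refine Finset.sum_le_sum fun m _ => ?_
    by_cases hm : k < m
    · simp [hc1 m hm]
    · have := hanti (not_lt.1 hm)
      rw [← sq]
      gcongr
  have hDpos : 0 ≤ D := (abs_nonneg _).trans (hD k k le_rfl le_rfl)
  have hup : y ⬝ᵥ (M *ᵥ y) ≤ D * (n * (y ⬝ᵥ y)) := by
    have h1 : (∑ i, |y i|) ^ 2 ≤ n * (y ⬝ᵥ y) := by
      have := sq_sum_le_card_mul_sum_sq (s := Finset.univ) (f := fun i => |y i|)
      simpa [dotProduct, ← sq] using this
    refine le_trans ?_ (mul_le_mul_of_nonneg_left h1 hDpos)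
    rw [sq, Finset.sum_mul_sum, Finset.mul_sum, dotProduct]
    refine Finset.sum_le_sum fun i _ => ?_
    rw [mulVec, dotProduct, Finset.mul_sum, Finset.mul_sum]
    refine Finset.sum_le_sum fun j _ => ?_
    by_cases hi : i < k
    · simp [hy1 i hi]
    by_cases hj : j < k
    · simp [hy1 j hj]
    calc y i * (M i j * y j) ≤ |y i * (M i j * y j)| := le_abs_self _
      _ = |M i j| * (|y i| * |y j|) := by rw [abs_mul, abs_mul]; ring
      _ ≤ D * (|y i| * |y j|) := by
        gcongr
        exact hD i j (not_lt.1 hi) (not_lt.1 hj)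
  rw [hyy] at hup
  have h2 : lam k * (c ⬝ᵥ c) ≤ n * D * (c ⬝ᵥ c) := by
    calc _ ≤ _ := hlow.trans hup
      _ = _ := by ring
  exact le_of_mul_le_mul_right h2 hcpos

/-- The dual choice: `y` combines eigenvectors with index at least `k` and vanishes in the
coordinates after `k`, so `M` stretches it by at most `lam k`. It serves to bound `lam k` from
below. -/
theorem HasOrderedSpectrum.exists_small_image {n : ℕ} {M : Matrix (Fin n) (Fin n) ℝ}
    {lam : Fin n → ℝ} (h : HasOrderedSpectrum M lam) (hnn : ∀ m, 0 ≤ lam m) (k : Fin n) :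
    ∃ (y : Fin n → ℝ) (j : Fin n), y j = 1 ∧ (∀ i, k < i → y i = 0) ∧
      ∀ i, |(M *ᵥ y) i| ≤ n * lam k := by
  obtain ⟨hanti, U, hU, hMU⟩ := h
  obtain ⟨c, hc, hcz⟩ := exists_ne_zero_mulVec_eq_zero
    (Matrix.of fun i j => if k < i then U i j else (1 : Matrix (Fin n) (Fin n) ℝ) i j) k
  have hc1 : ∀ i, i < k → c i = 0 := by
    intro i hi
    have := hcz i hi.ne
    simpa [mulVec, dotProduct, not_lt.2 hi.le, one_apply] using this
  have hy1 : ∀ i, k < i → (U *ᵥ c) i = 0 := by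
    intro i hi
    have := hcz i hi.ne'
    simpa [mulVec, dotProduct, hi] using this
  set y := U *ᵥ c with hy
  have hyy : y ⬝ᵥ y = c ⬝ᵥ c := by rw [hy, dotProduct_mulVec_mulVec, hU, one_mulVec]
  have hcpos : 0 < c ⬝ᵥ c := lt_of_le_of_ne
    (Finset.sum_nonneg fun i _ => mul_self_nonneg _) (Ne.symm (by simpa using hc))
  have hMy : (M *ᵥ y) ⬝ᵥ (M *ᵥ y) = ∑ m, (lam m * c m) ^ 2 := by
    rw [hy, mulVec_mulVec, hMU, ← mulVec_mulVec, dotProduct_mulVec_mulVec, hU, one_mulVec]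
    simp only [dotProduct, mulVec_diagonal]
    exact Finset.sum_congr rfl fun m _ => by ring
  -- Dividing by the coordinate of largest modulus makes the squared norm at most `n`; the constant
  -- `n` in the conclusion is a crude `√n`.
  obtain ⟨j, -, hj⟩ := Finset.exists_max_image Finset.univ (fun i => |y i|) ⟨k, Finset.mem_univ k⟩
  have hyle : y ⬝ᵥ y ≤ n * |y j| ^ 2 := by
    have : ∀ i ∈ Finset.univ, y i * y i ≤ |y j| ^ 2 := fun i _ => by
      rw [← sq, ← sq_abs]
      exact pow_le_pow_left₀ (abs_nonneg _) (hj i (Finset.mem_univ i)) 2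
    simpa [dotProduct] using Finset.sum_le_card_nsmul _ _ _ this
  have hj0 : y j ≠ 0 := by
    intro h0
    rw [h0, hyy] at hyle
    simp at hyle
    linarith
  refine ⟨(y j)⁻¹ • y, j, by simp [hj0], fun i hi => by simp [hy1 i hi], fun i => ?_⟩
  rw [mulVec_smul, Pi.smul_apply, smul_eq_mul, abs_mul, abs_inv,
    inv_mul_le_iff₀ (abs_pos.2 hj0), mul_comm]
  have hn : (1 : ℝ) ≤ n := by exact_mod_cast (Nat.succ_le_of_lt (k.pos))
  have h1 : (M *ᵥ y) i ^ 2 ≤ (M *ᵥ y) ⬝ᵥ (M *ᵥ y) := by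
    rw [sq]
    exact Finset.single_le_sum (f := fun i => (M *ᵥ y) i * (M *ᵥ y) i)
      (fun i _ => mul_self_nonneg _) (Finset.mem_univ i)
  have h2 : (M *ᵥ y) ⬝ᵥ (M *ᵥ y) ≤ lam k ^ 2 * (y ⬝ᵥ y) := by
    rw [hMy, hyy, dotProduct, Finset.mul_sum]
    refine Finset.sum_le_sum fun m _ => ?_
    by_cases hm : m < k
    · simp [hc1 m hm]
    · have := hanti (not_lt.1 hm)
      have := hnn m
      rw [mul_pow, ← sq]
      gcongr
  have hlk := hnn k
  refine abs_le_of_sq_le_sq (h1.trans (h2.trans ?_)) (by positivity)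
  calc lam k ^ 2 * (y ⬝ᵥ y) ≤ lam k ^ 2 * (n * |y j| ^ 2) := by gcongr
    _ ≤ lam k ^ 2 * (n ^ 2 * |y j| ^ 2) := by gcongr; nlinarith
    _ = (n * lam k * |y j|) ^ 2 := by ring

theorem hasOrderedSpectrum_sortedEigenvalue {n : ℕ} {M : Matrix (Fin n) (Fin n) ℝ}
    (hM : M.IsHermitian) : HasOrderedSpectrum M (sortedEigenvalue M) := by
  have hs : sortedEigenvalue M = fun k => hM.eigenvalues₀ (Fin.cast (Fintype.card_fin n).symm k) := by
    funext k
    simp only [sortedEigenvalue, dif_pos hM]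
  set e : Fin n ≃ Fin n := (finCongr (Fintype.card_fin n).symm).trans
    (Fintype.equivOfCardEq (Fintype.card_fin _))
  have hs' : ∀ k, sortedEigenvalue M k = hM.eigenvalues (e k) := by
    intro k
    rw [hs]
    simp [IsHermitian.eigenvalues, e]
  refine ⟨?_, (hM.eigenvectorUnitary : Matrix (Fin n) (Fin n) ℝ).submatrix id e, ?_, ?_⟩
  · rw [hs]
    intro i j hij
    exact hM.eigenvalues₀_antitone (by simpa using hij)
  · have h1 : (hM.eigenvectorUnitary : Matrix (Fin n) (Fin n) ℝ)ᵀ * hM.eigenvectorUnitary = 1 := by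
      have := Unitary.coe_star_mul_self hM.eigenvectorUnitary
      simpa [star_eq_conjTranspose] using this
    ext i j
    have := congrFun (congrFun h1 (e i)) (e j)
    simpa [mul_apply, one_apply] using this
  · ext i j
    have := congrFun (hM.mulVec_eigenvectorBasis (e j)) i
    rw [mul_diagonal, hs']
    simp only [Pi.smul_apply, smul_eq_mul] at this
    rw [mul_comm]
    exact this

/-- A unit vector in the range of each projector gives `n` orthonormal vectors, hence a basis, on
which `P k` acts as `p kᵀ` followed by `p k`. The rank hypothesis enters only as `P k ≠ 0`. -/
theorem exists_orthonormal_of_projectors {n : ℕ} {A : Matrix (Fin n) (Fin n) ℝ} {lam : Fin n → ℝ}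
    {P : Fin n → Matrix (Fin n) (Fin n) ℝ} (hsymm : ∀ k, (P k)ᵀ = P k)
    (horth : ∀ k l, P k * P l = if k = l then P k else 0) (hrank : ∀ k, (P k).rank = 1)
    (hA : A = ∑ k, lam k • P k) :
    ∃ U : Matrix (Fin n) (Fin n) ℝ, Uᵀ * U = 1 ∧ A * U = U * diagonal lam ∧
      ∀ k, P k = vecMulVec (fun i => U i k) fun i => U i k := by
  have hex : ∀ k, ∃ p : Fin n → ℝ, p ⬝ᵥ p = 1 ∧ P k *ᵥ p = p := by
    intro k
    have hne : P k ≠ 0 := by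
      intro h0
      have := hrank k
      simp [h0] at this
    have : ∃ v, P k *ᵥ v ≠ 0 := by
      by_contra! hz
      exact hne (Matrix.ext_of_mulVec_single fun i => by rw [hz, zero_mulVec])
    obtain ⟨v, hv⟩ := this
    set y := P k *ᵥ v with hy
    have hPy : P k *ᵥ y = y := by rw [hy, mulVec_mulVec, horth, if_pos rfl]
    have hpos : 0 < y ⬝ᵥ y := lt_of_le_of_ne
      (Finset.sum_nonneg fun i _ => mul_self_nonneg _) (Ne.symm (by simpa using hv))
    refine ⟨(√(y ⬝ᵥ y))⁻¹ • y, ?_, by rw [mulVec_smul, hPy]⟩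
    have h1 := Real.mul_self_sqrt hpos.le
    have h2 : √(y ⬝ᵥ y) ≠ 0 := (Real.sqrt_pos.2 hpos).ne'
    rw [smul_dotProduct, dotProduct_smul, smul_eq_mul, smul_eq_mul]
    field_simp
    rw [sq, h1]
  choose p hp1 hp2 using hex
  have hPp : ∀ k l, P k *ᵥ p l = if k = l then p k else 0 := by
    intro k l
    by_cases hkl : k = l
    · subst hkl; simp [hp2]
    · rw [← hp2 l, mulVec_mulVec, horth, if_neg hkl, if_neg hkl, zero_mulVec]
  have hpp : ∀ k l, p k ⬝ᵥ p l = if k = l then 1 else 0 := by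
    intro k l
    by_cases hkl : k = l
    · subst hkl; simp [hp1]
    · have : p k ⬝ᵥ p l = p k ⬝ᵥ (P k *ᵥ p l) := by
        conv_lhs => rw [← hp2 k]
        conv_rhs => rw [dotProduct_mulVec, ← mulVec_transpose, hsymm]
      rw [this, hPp, if_neg hkl, if_neg hkl, dotProduct_zero]
  set U : Matrix (Fin n) (Fin n) ℝ := Matrix.of fun i k => p k i with hU
  have hUU : Uᵀ * U = 1 := by
    ext k l
    rw [one_apply, ← hpp k l]
    simp [mul_apply, dotProduct, hU]
  have hPU : ∀ k, P k * U = Matrix.of fun i l => if k = l then p k i else 0 := by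
    intro k
    ext i l
    have := congrFun (hPp k l) i
    by_cases hkl : k = l
    · simpa [hkl, mulVec, mul_apply, dotProduct, hU] using this
    · simpa [hkl, mulVec, mul_apply, dotProduct, hU] using this
  refine ⟨U, hUU, ?_, fun k => ?_⟩
  · rw [hA, Finset.sum_mul]
    ext i l
    rw [mul_diagonal, Matrix.sum_apply, Finset.sum_eq_single l]
    · rw [smul_mul, Matrix.smul_apply, hPU]
      simp [hU, mul_comm]
    · intro k _ hkl
      rw [smul_mul, Matrix.smul_apply, hPU]
      simp [hkl]
    · simp
  · calc P k = P k * U * Uᵀ := by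
          rw [Matrix.mul_assoc, mul_eq_one_comm.1 hUU, Matrix.mul_one]
      _ = _ := by
        rw [hPU]
        ext i j
        simp [mul_apply, vecMulVec_apply, hU]

/-! ### QR factorizations of Vandermonde matrices -/

theorem exists_isFullQR {n : ℕ} (V : Matrix (Fin n) (Fin n) ℝ) : ∃ Q R, IsFullQR V Q R := by
  set f : Fin n → EuclideanSpace ℝ (Fin n) := fun j => WithLp.toLp 2 fun i => V i j with hf
  have hfin : Module.finrank ℝ (EuclideanSpace ℝ (Fin n)) = Fintype.card (Fin n) := by simp
  set b := InnerProductSpace.gramSchmidtOrthonormalBasis hfin f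
  set Q : Matrix (Fin n) (Fin n) ℝ := Matrix.of fun i j => b j i with hQ
  have hin : ∀ u v : EuclideanSpace ℝ (Fin n), inner ℝ u v = ∑ i, u i * v i := by
    intro u v
    simp [PiLp.inner_apply, mul_comm]
  have hQQ : Qᵀ * Q = 1 := by
    ext i j
    rw [one_apply, ← orthonormal_iff_ite.1 b.orthonormal i j, hin]
    simp [mul_apply, hQ]
  refine ⟨Q, Qᵀ * V, hQQ, fun i j hij => ?_, ?_⟩
  · have := InnerProductSpace.gramSchmidtOrthonormalBasis_inv_triangular hfin f
      (i := j) (j := i) hij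
    rw [hin] at this
    simpa [mul_apply, hQ, hf] using this
  · rw [← Matrix.mul_assoc, mul_eq_one_comm.1 hQQ, Matrix.one_mul]

theorem IsFullQR.transpose_mul {n m : ℕ} {V : Matrix (Fin n) (Fin m) ℝ}
    {Q : Matrix (Fin n) (Fin n) ℝ} {R : Matrix (Fin n) (Fin m) ℝ} (h : IsFullQR V Q R) :
    Qᵀ * V = R := by
  rw [h.eq, ← Matrix.mul_assoc, h.orth, Matrix.one_mul]

/-- Column `k` of `V = Q R` reads `R_kk q_k = x^k - ∑_{l<k} R_lk q_l`, by induction the values of a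
monic polynomial of degree `k`. If `R_kk` were zero, this polynomial would vanish at `n > k`
distinct points. -/
theorem IsFullQR.exists_polynomial {n s : ℕ} (hs : s ≤ n) {x : Fin n → ℝ}
    (hx : Function.Injective x) {Q : Matrix (Fin n) (Fin n) ℝ} {R : Matrix (Fin n) (Fin s) ℝ}
    (h : IsFullQR (vander x s) Q R) (k : ℕ) (hk : k < s) :
    R ⟨k, hk.trans_le hs⟩ ⟨k, hk⟩ ≠ 0 ∧
      ∃ p : Polynomial ℝ, p.degree = k ∧ ∀ i, Q i ⟨k, hk.trans_le hs⟩ = p.eval (x i) := by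
  induction k using Nat.strong_induction_on with
  | _ k ih =>
    have hφ : ∀ l : Fin n, ∃ p : Polynomial ℝ,
        (l : ℕ) < k → p.degree = (l : ℕ) ∧ ∀ i, Q i l = p.eval (x i) := by
      intro l
      by_cases hl : (l : ℕ) < k
      · obtain ⟨p, hp⟩ := (ih l hl (hl.trans hk)).2
        exact ⟨p, fun _ => hp⟩
      · exact ⟨0, fun h' => absurd h' hl⟩
    choose φ hφ using hφ
    set kn : Fin n := ⟨k, hk.trans_le hs⟩ with hkn
    set ks : Fin s := ⟨k, hk⟩ with hks
    set g : Polynomial ℝ := Polynomial.X ^ k - ∑ l with l < kn, Polynomial.C (R l ks) * φ l with hg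
    have hdeg : g.degree = k := by
      rw [hg, Polynomial.degree_sub_eq_left_of_degree_lt, Polynomial.degree_X_pow]
      rw [Polynomial.degree_X_pow, ← Polynomial.mem_degreeLT]
      refine Submodule.sum_mem _ fun l hl => ?_
      have hl' : (l : ℕ) < k := (Finset.mem_filter.1 hl).2
      rw [Polynomial.mem_degreeLT]
      rw [← Polynomial.smul_eq_C_mul]
      refine (Polynomial.degree_smul_le _ _).trans_lt ?_
      rw [(hφ l hl').1]
      exact_mod_cast hl'
    have heval : ∀ i, g.eval (x i) = R kn ks * Q i kn := by
      intro i
      have h1 : x i ^ k = ∑ l, Q i l * R l ks := by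
        have := congrFun (congrFun h.eq i) ks
        simpa [vander, mul_apply, hks] using this
      have h2 : ∑ l, Q i l * R l ks = ∑ l with l < kn, R l ks * Q i l + R kn ks * Q i kn := by
        rw [← Finset.sum_filter_add_sum_filter_not Finset.univ (fun l => l < kn)]
        congr 1
        · exact Finset.sum_congr rfl fun l _ => mul_comm _ _
        · rw [Finset.sum_eq_single kn, mul_comm]
          · intro l hl hne
            have : kn < l := lt_of_le_of_ne (not_lt.1 (Finset.mem_filter.1 hl).2) hne.symm
            rw [h.upper l ks this, mul_zero]
          · simp
      rw [hg, Polynomial.eval_sub, Polynomial.eval_pow, Polynomial.eval_X, h1, h2,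
        Polynomial.eval_finsetSum, add_sub_assoc, add_comm, sub_add, sub_eq_self, sub_eq_zero]
      refine Finset.sum_congr rfl fun l hl => ?_
      rw [Polynomial.eval_mul, Polynomial.eval_C, (hφ l (Finset.mem_filter.1 hl).2).2 i]
    have hg0 : g ≠ 0 := by
      intro h0
      simp [h0] at hdeg
    have hR : R kn ks ≠ 0 := by
      intro h0
      refine hg0 (Polynomial.eq_zero_of_natDegree_lt_card_of_eval_eq_zero g hx (fun i => ?_) ?_)
      · rw [heval, h0, zero_mul]
      · rw [Polynomial.natDegree_eq_of_degree_eq_some hdeg, Fintype.card_fin]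
        exact hk.trans_le hs
    refine ⟨hR, Polynomial.C (R kn ks)⁻¹ * g, ?_, fun i => ?_⟩
    · rw [Polynomial.degree_C_mul (inv_ne_zero hR), hdeg]
    · rw [Polynomial.eval_mul, Polynomial.eval_C, heval, inv_mul_cancel_left₀ hR]

theorem IsFullQR.exists_isDiscreteOrthonormal {n s : ℕ} (hs : s ≤ n) {x : Fin n → ℝ}
    (hx : Function.Injective x) {Q : Matrix (Fin n) (Fin n) ℝ} {R : Matrix (Fin n) (Fin s) ℝ}
    (h : IsFullQR (vander x s) Q R) :
    ∃ φ : ℕ → Polynomial ℝ, IsDiscreteOrthonormal x s φ ∧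
      ∀ k : Fin n, (k : ℕ) < s → ∀ i, Q i k = (φ k).eval (x i) := by
  have hφ : ∀ k, ∃ p : Polynomial ℝ, ∀ hk : k < s,
      p.degree = k ∧ ∀ i, Q i ⟨k, hk.trans_le hs⟩ = p.eval (x i) := by
    intro k
    by_cases hk : k < s
    · obtain ⟨p, hp⟩ := (h.exists_polynomial hs hx k hk).2
      exact ⟨p, fun _ => hp⟩
    · exact ⟨0, fun h' => absurd h' hk⟩
  choose φ hφ using hφ
  refine ⟨φ, ⟨fun k hk => (hφ k hk).1, fun k hk l hl => ?_⟩, fun k hk => (hφ k hk).2⟩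
  have := congrFun (congrFun h.orth ⟨k, hk.trans_le hs⟩) ⟨l, hl.trans_le hs⟩
  simp only [mul_apply, transpose_apply, one_apply, Fin.mk.injEq] at this
  rw [← this]
  exact Finset.sum_congr rfl fun i _ => by rw [(hφ k hk).2 i, (hφ l hl).2 i]

theorem sum_castLE {n m : ℕ} (h : m ≤ n) (f : Fin n → ℝ) :
    ∑ j, f j = ∑ j : Fin m, f (Fin.castLE h j) + ∑ j : Fin n, if (j : ℕ) < m then 0 else f j := by
  obtain ⟨p, rfl⟩ := Nat.exists_eq_add_of_le h
  rw [Fin.sum_univ_add, Fin.sum_univ_add (fun j : Fin (m + p) => if (j : ℕ) < m then 0 else f j)]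
  simp
  rfl

/-- The rows of `R` below the `m`-th vanish in the first `m` columns, so `VᵀV = TᵀT` with `T` the
triangular leading block of `R`. -/
theorem IsFullQR.det_gram {n s : ℕ} (hs : s ≤ n) {x : Fin n → ℝ}
    {Q : Matrix (Fin n) (Fin n) ℝ} {R : Matrix (Fin n) (Fin s) ℝ}
    (h : IsFullQR (vander x s) Q R) {m : ℕ} (hm : m ≤ s) :
    ((vander x m)ᵀ * vander x m).det
      = ∏ i : Fin m, R (Fin.castLE (hm.trans hs) i) (Fin.castLE hm i) ^ 2 := by
  set T : Matrix (Fin m) (Fin m) ℝ := R.submatrix (Fin.castLE (hm.trans hs)) (Fin.castLE hm) with hT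
  have h1 : vander x m = Q * R.submatrix id (Fin.castLE hm) := by
    ext i j
    have := congrFun (congrFun h.eq i) (Fin.castLE hm j)
    simpa [vander, mul_apply] using this
  have h2 : (vander x m)ᵀ * vander x m = Tᵀ * T := by
    rw [h1, Matrix.transpose_mul, Matrix.mul_assoc, ← Matrix.mul_assoc Qᵀ, h.orth, Matrix.one_mul]
    ext i j
    simp only [mul_apply, transpose_apply, submatrix_apply, id, hT]
    rw [sum_castLE (hm.trans hs), add_eq_left]
    refine Finset.sum_eq_zero fun l _ => ?_
    split_ifs with hl
    · rfl
    · rw [h.upper l _ (by simp; omega), zero_mul]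
  have h3 : T.det = ∏ i, T i i := det_of_isUpperTriangular fun i j hij =>
    h.upper _ _ (by simpa using hij)
  rw [h2, det_mul, det_transpose, ← sq, h3, Finset.prod_pow]
  rfl

end FlatLimit

namespace FlatLimit

/-! ### Asymptotics of eigenvalues and eigenvectors of graded matrices -/

/-- The leading `m × m` submatrix. -/
def leading {n : ℕ} (B : Matrix (Fin n) (Fin n) ℝ) (m : ℕ) (h : m ≤ n) : Matrix (Fin m) (Fin m) ℝ :=
  B.submatrix (Fin.castLE h) (Fin.castLE h)

theorem isBigO_pow_pow {p q : ℕ} (h : p ≤ q) :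
    (fun ε : ℝ => ε ^ q) =O[𝓝[>] 0] fun ε => ε ^ p := by
  refine IsBigO.of_bound 1 ?_
  have h1 : ∀ᶠ ε in 𝓝[>] (0 : ℝ), ε < 1 := (gt_mem_nhds one_pos).filter_mono nhdsWithin_le_nhds
  filter_upwards [h1, self_mem_nhdsWithin] with ε h2 h3
  have hε : (0 : ℝ) < ε := h3
  rw [one_mul, Real.norm_of_nonneg (by positivity), Real.norm_of_nonneg (by positivity)]
  exact pow_le_pow_of_le_one hε.le h2.le h

theorem isBigO_of_pow_mul {p : ℕ} {f g : ℝ → ℝ}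
    (h : (fun ε => ε ^ p * f ε) =O[𝓝[>] 0] fun ε => ε ^ p * g ε) : f =O[𝓝[>] 0] g := by
  obtain ⟨c, hc⟩ := h.bound
  refine IsBigO.of_bound c ?_
  filter_upwards [hc, self_mem_nhdsWithin] with ε h1 h2
  have hp : 0 < ‖ε ^ p‖ := norm_pos_iff.2 (pow_pos h2 p).ne'
  rw [norm_mul, norm_mul] at h1
  nlinarith

theorem isBigO_of_mulVec {m : ℕ} {T : ℝ → Matrix (Fin m) (Fin m) ℝ} (hT : ContinuousAt T 0)
    (hdet : (T 0).det ≠ 0) {v : ℝ → Fin m → ℝ} {g : ℝ → ℝ}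
    (h : ∀ i, (fun ε => (T ε *ᵥ v ε) i) =O[𝓝[>] 0] g) (i : Fin m) :
    (fun ε => v ε i) =O[𝓝[>] 0] g := by
  have hd : ContinuousAt (fun ε => (T ε).det) 0 :=
    (continuous_id.matrix_det).continuousAt.comp hT
  have hadj : ∀ j, (fun ε => (T ε).adjugate i j) =O[𝓝[>] 0] fun _ => (1 : ℝ) := fun j =>
    ((((continuous_id.matrix_adjugate).matrix_elem i j).continuousAt.comp hT).tendsto.mono_left
      nhdsWithin_le_nhds).isBigO_one ℝ
  have hinv : (fun ε => ((T ε).det)⁻¹) =O[𝓝[>] 0] fun _ => (1 : ℝ) :=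
    ((hd.inv₀ hdet).tendsto.mono_left nhdsWithin_le_nhds).isBigO_one ℝ
  have key : (fun ε => ((T ε).det)⁻¹ * ∑ j, (T ε).adjugate i j * (T ε *ᵥ v ε) j) =O[𝓝[>] 0]
      fun ε => 1 * (1 * g ε) :=
    hinv.mul (IsBigO.fun_sum fun j _ => (hadj j).mul (h j))
  simp only [one_mul] at key
  refine key.congr' ?_ EventuallyEq.rfl
  filter_upwards [(hd.eventually_ne hdet).filter_mono nhdsWithin_le_nhds] with ε hε
  have : (T ε).adjugate *ᵥ (T ε *ᵥ v ε) = (T ε).det • v ε := by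
    rw [mulVec_mulVec, adjugate_mul, smul_mulVec, one_mulVec]
  have h2 := congrFun this i
  rw [Pi.smul_apply, smul_eq_mul] at h2
  rw [inv_mul_eq_iff_eq_mul₀ hε, ← h2]
  rfl

/-- A scalar may be estimated coordinatewise against a unit vector, since `f = ∑ u_i (f u_i)`; no
coordinate has to be bounded away from zero. -/
theorem isBigO_of_unit {n : ℕ} {u : ℝ → Fin n → ℝ} (hu : ∀ᶠ ε in 𝓝[>] (0 : ℝ), u ε ⬝ᵥ u ε = 1)
    {f g : ℝ → ℝ} (h : ∀ i, (fun ε => f ε * u ε i) =O[𝓝[>] 0] g)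
    (hu1 : ∀ i, (fun ε => u ε i) =O[𝓝[>] 0] fun _ => (1 : ℝ)) : f =O[𝓝[>] 0] g := by
  have key : (fun ε => ∑ i, u ε i * (f ε * u ε i)) =O[𝓝[>] 0] fun ε => 1 * g ε :=
    IsBigO.fun_sum fun i _ => (hu1 i).mul (h i)
  simp only [one_mul] at key
  refine key.congr' ?_ EventuallyEq.rfl
  filter_upwards [hu] with ε hε
  calc ∑ i, u ε i * (f ε * u ε i) = f ε * (u ε ⬝ᵥ u ε) := by
        rw [dotProduct, Finset.mul_sum]; exact Finset.sum_congr rfl fun i _ => by ring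
    _ = f ε := by rw [hε, mul_one]

theorem isBigO_one_of_unit {n : ℕ} {u : ℝ → Fin n → ℝ}
    (hu : ∀ᶠ ε in 𝓝[>] (0 : ℝ), u ε ⬝ᵥ u ε = 1) (i : Fin n) :
    (fun ε => u ε i) =O[𝓝[>] 0] fun _ => (1 : ℝ) := by
  refine IsBigO.of_bound 1 ?_
  filter_upwards [hu] with ε hε
  have h1 : u ε i * u ε i ≤ u ε ⬝ᵥ u ε :=
    Finset.single_le_sum (f := fun i => u ε i * u ε i) (fun i _ => mul_self_nonneg _)
      (Finset.mem_univ i)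
  rw [hε] at h1
  simpa using abs_le_of_sq_le_sq (a := u ε i) (b := 1) (by nlinarith) zero_le_one

/-- A symmetric matrix function `M ε`, with entries `ε ^ (w i + w j) * B ε i j`, with its ordered
eigenvalues `lam ε` for `ε > 0`. The weights are `w i = i` for `i ≤ k` and larger than `k`
for `i > k`. -/
structure IsGraded {n : ℕ} (M B : ℝ → Matrix (Fin n) (Fin n) ℝ) (lam : ℝ → Fin n → ℝ)
    (w : Fin n → ℕ) (k : Fin n) : Prop where
  weight_le : ∀ i ≤ k, w i = i
  weight_gt : ∀ i, k < i → (k : ℕ) + 1 ≤ w i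
  analytic : ∀ i j, AnalyticAt ℝ (fun ε => B ε i j) 0
  eq : ∀ᶠ ε in 𝓝[>] (0 : ℝ), ∀ i j, M ε i j = ε ^ (w i + w j) * B ε i j
  spectrum : ∀ᶠ ε in 𝓝[>] (0 : ℝ), HasOrderedSpectrum (M ε) (lam ε)
  nonneg : ∀ᶠ ε in 𝓝[>] (0 : ℝ), ∀ m, 0 ≤ lam ε m

namespace IsGraded

variable {n : ℕ} {M B : ℝ → Matrix (Fin n) (Fin n) ℝ} {lam : ℝ → Fin n → ℝ} {w : Fin n → ℕ}
  {k : Fin n}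

theorem continuousAt_leading (h : IsGraded M B lam w k) (m : ℕ) (hm : m ≤ n) :
    ContinuousAt (fun ε => leading (B ε) m hm) 0 :=
  continuousAt_pi.2 fun _ => continuousAt_pi.2 fun _ => (h.analytic _ _).continuousAt

theorem isBigO_entry (h : IsGraded M B lam w k) (i j : Fin n) :
    (fun ε => B ε i j) =O[𝓝[>] 0] fun _ => (1 : ℝ) :=
  ((h.analytic i j).continuousAt.tendsto.mono_left nhdsWithin_le_nhds).isBigO_one ℝ

theorem det_sub_isBigO (h : IsGraded M B lam w k) (m : ℕ) (hm : m ≤ n) :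
    (fun ε => (leading (B ε) m hm).det - (leading (B 0) m hm).det) =O[𝓝[>] 0]
      fun ε : ℝ => ε ^ 1 := by
  have hd : DifferentiableAt ℝ (fun ε => (leading (B ε) m hm).det) 0 := by
    simp only [det_apply]
    refine DifferentiableAt.fun_sum fun σ _ => DifferentiableAt.const_smul ?_ _
    exact DifferentiableAt.fun_finsetProd fun i _ => (h.analytic _ _).differentiableAt
  simpa using hd.isBigO_sub.mono (nhdsWithin_le_nhds (s := Set.Ioi 0))

theorem weight_ge (h : IsGraded M B lam w k) {i : Fin n} (hi : k ≤ i) : (k : ℕ) ≤ w i := by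
  rcases hi.eq_or_lt with rfl | hi
  · rw [h.weight_le k le_rfl]
  · exact (Nat.le_succ _).trans (h.weight_gt i hi)

/-- Entries with both indices at least `k` have total weight at least `2k`, so `le_of_entries`
applies with `D` of order `ε ^ (2k)`. -/
theorem eigenvalue_isBigO (h : IsGraded M B lam w k) :
    (fun ε => lam ε k) =O[𝓝[>] 0] fun ε => ε ^ (2 * (k : ℕ)) := by
  choose C hC using fun i j => (h.isBigO_entry i j).bound
  set D := ∑ i, ∑ j, |C i j| with hD
  have hCD : ∀ i j, C i j ≤ D := fun i j =>
    (le_abs_self _).trans ((Finset.single_le_sum (f := fun j => |C i j|) (fun _ _ => abs_nonneg _)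
      (Finset.mem_univ j)).trans (Finset.single_le_sum (f := fun i => ∑ j, |C i j|)
      (fun _ _ => Finset.sum_nonneg fun _ _ => abs_nonneg _) (Finset.mem_univ i)))
  refine IsBigO.of_bound (n * D) ?_
  have h1 : ∀ᶠ ε in 𝓝[>] (0 : ℝ), ε < 1 := (gt_mem_nhds one_pos).filter_mono nhdsWithin_le_nhds
  filter_upwards [h.eq, h.spectrum, h.nonneg, self_mem_nhdsWithin, h1,
    eventually_all.2 fun i => eventually_all.2 (hC i)] with ε e1 e2 e3 e4 e5 e6
  have hε : (0 : ℝ) < ε := e4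
  rw [Real.norm_of_nonneg (e3 k), Real.norm_of_nonneg (by positivity), mul_assoc]
  refine e2.le_of_entries k fun i j hi hj => ?_
  have h2 := (e6 i j)
  rw [norm_one, mul_one, Real.norm_eq_abs] at h2
  rw [e1, abs_mul, abs_of_pos (by positivity), mul_comm]
  have h3 : ε ^ (w i + w j) ≤ ε ^ (2 * (k : ℕ)) :=
    pow_le_pow_of_le_one hε.le e5.le (by have := h.weight_ge hi; have := h.weight_ge hj; omega)
  exact mul_le_mul (h2.trans (hCD i j)) h3 (by positivity)
    (Finset.sum_nonneg fun _ _ => Finset.sum_nonneg fun _ _ => abs_nonneg _)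

theorem mulVec_eq (h : IsGraded M B lam w k) : ∀ᶠ ε in 𝓝[>] (0 : ℝ), ∀ (v : Fin n → ℝ) (i : Fin n),
    (M ε *ᵥ v) i = ε ^ w i * ∑ j, B ε i j * (ε ^ w j * v j) := by
  filter_upwards [h.eq] with ε hε v i
  rw [mulVec, dotProduct, Finset.mul_sum]
  refine Finset.sum_congr rfl fun j _ => ?_
  rw [hε, pow_add]
  ring

/-- A vector `y` supported on the first `k + 1` coordinates has image `O(λ_k)`. Inverting the
leading block of `B` bounds its rescaled coordinates by `λ_k`, while one coordinate of `y` equals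
`1`. -/
theorem isBigO_eigenvalue (h : IsGraded M B lam w k)
    (hdet : (leading (B 0) (k + 1) k.isLt).det ≠ 0) :
    (fun ε => ε ^ (2 * (k : ℕ))) =O[𝓝[>] 0] fun ε => lam ε k := by
  have hex : ∀ ε, ∃ (y : Fin n → ℝ) (j : Fin n), HasOrderedSpectrum (M ε) (lam ε) →
      (∀ m, 0 ≤ lam ε m) → y j = 1 ∧ (∀ i, k < i → y i = 0) ∧
        ∀ i, |(M ε *ᵥ y) i| ≤ n * lam ε k := by
    intro ε
    by_cases h1 : HasOrderedSpectrum (M ε) (lam ε) ∧ ∀ m, 0 ≤ lam ε m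
    · obtain ⟨y, j, hy⟩ := h1.1.exists_small_image h1.2 k
      exact ⟨y, j, fun _ _ => hy⟩
    · exact ⟨0, k, fun h2 h3 => absurd ⟨h2, h3⟩ h1⟩
  choose y j hy using hex
  have hyj : ∀ᶠ ε in 𝓝[>] (0 : ℝ), y ε (j ε) = 1 ∧ (∀ i, k < i → y ε i = 0) ∧
        ∀ i, |(M ε *ᵥ y ε) i| ≤ n * lam ε k := by
    filter_upwards [h.spectrum, h.nonneg] with ε h1 h2 using hy ε h1 h2
  have hMy : ∀ i, (fun ε => (M ε *ᵥ y ε) i) =O[𝓝[>] 0] fun ε => lam ε k := by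
    intro i
    refine IsBigO.of_bound n ?_
    filter_upwards [hyj, h.nonneg] with ε h1 h2
    rw [Real.norm_eq_abs, Real.norm_of_nonneg (h2 k)]
    exact h1.2.2 i
  -- Row `i` of `M y` carries a factor `ε ^ i`; multiplying it by `ε ^ (k - i)` gives all rows the
  -- factor `ε ^ k`, absorbed here into the unknowns.
  set v : ℝ → Fin (k + 1) → ℝ := fun ε i => ε ^ (k + i : ℕ) * y ε (Fin.castLE k.isLt i) with hv
  have hTv : ∀ i, (fun ε => (leading (B ε) (k + 1) k.isLt *ᵥ v ε) i) =O[𝓝[>] 0]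
      fun ε => lam ε k := by
    intro i
    have hik : Fin.castLE k.isLt i ≤ k := Fin.le_def.2 (by simp; omega)
    have h1 : (fun ε : ℝ => ε ^ (k - i : ℕ) * (M ε *ᵥ y ε) (Fin.castLE k.isLt i)) =O[𝓝[>] 0]
        fun ε => 1 * lam ε k :=
      IsBigO.mul (by simpa using isBigO_pow_pow (Nat.zero_le (k - i : ℕ))) (hMy _)
    simp only [one_mul] at h1
    refine h1.congr' ?_ EventuallyEq.rfl
    filter_upwards [h.mulVec_eq, hyj] with ε e1 e2
    rw [e1, h.weight_le _ hik, sum_castLE (m := k + 1) k.isLt, Finset.sum_eq_zero (s := Finset.univ)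
      (f := fun j : Fin n => if (j : ℕ) < (k : ℕ) + 1 then 0 else
        B ε (Fin.castLE k.isLt i) j * (ε ^ w j * y ε j)),
      add_zero]
    · rw [mulVec, dotProduct, ← mul_assoc, ← pow_add, Fin.val_castLE, Nat.sub_add_cancel (by omega),
        Finset.mul_sum]
      refine Finset.sum_congr rfl fun j _ => ?_
      rw [h.weight_le _ (Fin.le_def.2 (by simp; omega))]
      simp only [leading, submatrix_apply, hv, pow_add, Fin.val_castLE]
      ring
    · intro j _
      split_ifs with hj
      · rfl
      · rw [e2.2.1 j (Fin.lt_def.2 (by omega))]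
        simp
  have hv1 := isBigO_of_mulVec (h.continuousAt_leading _ k.isLt) hdet hTv
  have hy1 : ∀ i, (fun ε => ε ^ (2 * (k : ℕ)) * y ε i) =O[𝓝[>] 0] fun ε => lam ε k := by
    intro i
    by_cases hi : k < i
    · refine (isBigO_zero _ _).congr' ?_ EventuallyEq.rfl
      filter_upwards [hyj] with ε e
      rw [e.2.1 i hi, mul_zero]
    · have hik : (i : ℕ) ≤ k := Fin.le_def.1 (not_lt.1 hi)
      have h1 : (fun ε : ℝ => ε ^ (k - i : ℕ) * v ε ⟨i, by omega⟩) =O[𝓝[>] 0]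
          fun ε => 1 * lam ε k :=
        IsBigO.mul (by simpa using isBigO_pow_pow (Nat.zero_le (k - i : ℕ))) (hv1 _)
      simp only [one_mul] at h1
      refine h1.congr_left fun ε => ?_
      simp only [hv, ← mul_assoc, ← pow_add]
      congr 2
      omega
  have hsum : (fun ε => ∑ i, |ε ^ (2 * (k : ℕ)) * y ε i|) =O[𝓝[>] 0] fun ε => lam ε k :=
    IsBigO.fun_sum fun i _ => (hy1 i).abs_left
  refine IsBigO.trans (IsBigO.of_bound 1 ?_) hsum
  filter_upwards [hyj] with ε e
  rw [one_mul, Real.norm_of_nonneg (Finset.sum_nonneg fun _ _ => abs_nonneg _)]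
  calc ‖ε ^ (2 * (k : ℕ))‖ = |ε ^ (2 * (k : ℕ)) * y ε (j ε)| := by rw [e.1, mul_one]; rfl
    _ ≤ _ := Finset.single_le_sum (f := fun i => |ε ^ (2 * (k : ℕ)) * y ε i|)
      (fun _ _ => abs_nonneg _) (Finset.mem_univ _)

section Eigenvector

variable {u : ℝ → Fin n → ℝ}

theorem row_eq (h : IsGraded M B lam w k)
    (hu : ∀ᶠ ε in 𝓝[>] (0 : ℝ), u ε ⬝ᵥ u ε = 1 ∧ M ε *ᵥ u ε = lam ε k • u ε) :
    ∀ᶠ ε in 𝓝[>] (0 : ℝ), ∀ i, lam ε k * u ε i = ε ^ w i * ∑ j, B ε i j * (ε ^ w j * u ε j) := by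
  filter_upwards [h.mulVec_eq, hu] with ε e1 e2 i
  rw [← e1, e2.2, Pi.smul_apply, smul_eq_mul]

/-- Dividing row `i` by `ε ^ i` leaves order `2k - i`, which is at least `k + 1` when `i < k`. -/
theorem row_isBigO (h : IsGraded M B lam w k)
    (hu : ∀ᶠ ε in 𝓝[>] (0 : ℝ), u ε ⬝ᵥ u ε = 1 ∧ M ε *ᵥ u ε = lam ε k • u ε)
    {i : Fin n} (hi : i < k) :
    (fun ε => ∑ j, B ε i j * (ε ^ w j * u ε j)) =O[𝓝[>] 0] fun ε => ε ^ ((k : ℕ) + 1) := by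
  have hi' : (i : ℕ) < k := hi
  refine isBigO_of_pow_mul (p := i) ?_
  have h1 : (fun ε => lam ε k * u ε i) =O[𝓝[>] 0] fun ε : ℝ => ε ^ (2 * (k : ℕ)) * 1 :=
    h.eigenvalue_isBigO.mul (isBigO_one_of_unit (hu.mono fun _ h => h.1) i)
  simp only [mul_one] at h1
  have h2 : (fun ε : ℝ => ε ^ (2 * (k : ℕ))) =O[𝓝[>] 0]
      fun ε => ε ^ (i : ℕ) * ε ^ ((k : ℕ) + 1) := by
    simp only [← pow_add]
    exact isBigO_pow_pow (by omega)
  refine (h1.trans h2).congr' ?_ EventuallyEq.rfl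
  filter_upwards [h.row_eq hu] with ε e
  rw [e, h.weight_le i hi.le]

theorem tail_isBigO (h : IsGraded M B lam w k) (hu : ∀ᶠ ε in 𝓝[>] (0 : ℝ), u ε ⬝ᵥ u ε = 1)
    (i : Fin n) {m p : ℕ} (hp : ∀ j : Fin n, m ≤ (j : ℕ) → p ≤ w j) :
    (fun ε => ∑ j : Fin n, if (j : ℕ) < m then 0 else B ε i j * (ε ^ w j * u ε j)) =O[𝓝[>] 0]
      fun ε => ε ^ p := by
  refine IsBigO.fun_sum fun j _ => ?_
  split_ifs with hj
  · exact isBigO_zero _ _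
  · have := (h.isBigO_entry i j).mul ((isBigO_pow_pow (hp j (not_lt.1 hj))).mul
      (isBigO_one_of_unit hu j))
    simpa using this

/-- For `j ≥ k` the weight alone suffices. For `j < k` the first `k` rows form an invertible system
whose right-hand side, after moving the tail across, is `O(ε ^ k)`. -/
theorem scaled_isBigO (h : IsGraded M B lam w k)
    (hu : ∀ᶠ ε in 𝓝[>] (0 : ℝ), u ε ⬝ᵥ u ε = 1 ∧ M ε *ᵥ u ε = lam ε k • u ε)
    (hdet : (leading (B 0) k k.isLt.le).det ≠ 0) (j : Fin n) :
    (fun ε => ε ^ w j * u ε j) =O[𝓝[>] 0] fun ε => ε ^ (k : ℕ) := by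
  have hu1 := hu.mono fun _ h => h.1
  by_cases hj : j < k
  · have key := isBigO_of_mulVec (h.continuousAt_leading _ k.isLt.le) hdet
      (v := fun ε i => ε ^ w (Fin.castLE k.isLt.le i) * u ε (Fin.castLE k.isLt.le i))
      (g := fun ε => ε ^ (k : ℕ)) (fun i => ?_) ⟨j, hj⟩
    · exact key
    · have h1 := ((h.row_isBigO hu (i := Fin.castLE k.isLt.le i) (Fin.lt_def.2 i.isLt)).trans
        (isBigO_pow_pow (Nat.le_succ _))).sub
        (h.tail_isBigO hu1 (Fin.castLE k.isLt.le i) (m := k) (p := k)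
          fun j hj => h.weight_ge (Fin.le_def.2 hj))
      refine h1.congr_left fun ε => ?_
      rw [sum_castLE k.isLt.le, add_sub_cancel_right]
      rfl
  · simpa using (isBigO_pow_pow (h.weight_ge (not_lt.1 hj))).mul (isBigO_one_of_unit hu1 j)

theorem eigenvector_isBigO_of_lt (h : IsGraded M B lam w k)
    (hu : ∀ᶠ ε in 𝓝[>] (0 : ℝ), u ε ⬝ᵥ u ε = 1 ∧ M ε *ᵥ u ε = lam ε k • u ε)
    (hdet : (leading (B 0) k k.isLt.le).det ≠ 0) {i : Fin n} (hi : i < k) :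
    (fun ε => u ε i) =O[𝓝[>] 0] fun ε => ε ^ 1 := by
  have hi' : (i : ℕ) < k := hi
  refine isBigO_of_pow_mul (p := i) ?_
  have h1 := h.scaled_isBigO hu hdet i
  rw [h.weight_le i hi.le] at h1
  refine h1.trans ?_
  simp only [← pow_add]
  exact isBigO_pow_pow (by omega)

/-- For `i < k` the extra power of `ε` comes from `u_i`, for `i > k` from the weight of row `i`. No
bound on `u_i` itself is claimed for `i > k`, as `λ_k` may be of smaller order. -/
theorem eigenvalue_mul_isBigO (h : IsGraded M B lam w k)
    (hu : ∀ᶠ ε in 𝓝[>] (0 : ℝ), u ε ⬝ᵥ u ε = 1 ∧ M ε *ᵥ u ε = lam ε k • u ε)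
    (hdet : (leading (B 0) k k.isLt.le).det ≠ 0) {i : Fin n} (hi : i ≠ k) :
    (fun ε => lam ε k * u ε i) =O[𝓝[>] 0] fun ε => ε ^ (2 * (k : ℕ) + 1) := by
  rcases lt_or_gt_of_ne hi with hi | hi
  · simpa [pow_succ] using h.eigenvalue_isBigO.mul (h.eigenvector_isBigO_of_lt hu hdet hi)
  · have h1 : (fun ε => ε ^ w i * ∑ j, B ε i j * (ε ^ w j * u ε j)) =O[𝓝[>] 0]
        fun ε => ε ^ ((k : ℕ) + 1) * ε ^ (k : ℕ) := by
      refine (isBigO_pow_pow (h.weight_gt i hi)).mul (IsBigO.fun_sum fun j _ => ?_)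
      simpa using (h.isBigO_entry i j).mul (h.scaled_isBigO hu hdet j)
    simp only [← pow_add] at h1
    rw [show (k : ℕ) + 1 + k = 2 * k + 1 by ring] at h1
    refine h1.congr' ?_ EventuallyEq.rfl
    filter_upwards [h.row_eq hu] with ε e using (e i).symm

theorem leading_row_isBigO (h : IsGraded M B lam w k)
    (hu : ∀ᶠ ε in 𝓝[>] (0 : ℝ), u ε ⬝ᵥ u ε = 1 ∧ M ε *ᵥ u ε = lam ε k • u ε) (i : Fin (k + 1)) :
    (fun ε => ε ^ (k : ℕ) * (leading (B ε) (k + 1) k.isLt *ᵥ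
        fun j => ε ^ (j : ℕ) * u ε (Fin.castLE k.isLt j)) i
      - if i = Fin.last k then lam ε k * u ε k else 0) =O[𝓝[>] 0]
      fun ε => ε ^ (2 * (k : ℕ) + 1) := by
  have hu1 := hu.mono fun _ h => h.1
  have htail := h.tail_isBigO hu1 (Fin.castLE k.isLt i) (m := k + 1) (p := k + 1)
          fun j hj => h.weight_gt j (Fin.lt_def.2 hj)
  have hsplit : ∀ ε : ℝ, (leading (B ε) (k + 1) k.isLt *ᵥ
        fun j => ε ^ (j : ℕ) * u ε (Fin.castLE k.isLt j)) i
      = ∑ j, B ε (Fin.castLE k.isLt i) j * (ε ^ w j * u ε j)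
        - ∑ j : Fin n, if (j : ℕ) < k + 1 then 0 else
          B ε (Fin.castLE k.isLt i) j * (ε ^ w j * u ε j) := by
    intro ε
    rw [sum_castLE (m := k + 1) k.isLt, add_sub_cancel_right, mulVec, dotProduct]
    refine Finset.sum_congr rfl fun j _ => ?_
    rw [h.weight_le _ (Fin.le_def.2 (by simp; omega))]
    rfl
  have hpow : ∀ ε : ℝ, ε ^ (2 * (k : ℕ) + 1) = ε ^ (k : ℕ) * ε ^ ((k : ℕ) + 1) := fun ε => by
    rw [← pow_add]; congr 1; ring
  simp only [hpow, hsplit]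
  by_cases hi : i = Fin.last k
  · have hik : Fin.castLE k.isLt i = k := by rw [hi]; rfl
    have h1 := ((isBigO_refl (fun ε : ℝ => ε ^ (k : ℕ)) (𝓝[>] 0)).mul htail).neg_left
    refine h1.congr' ?_ EventuallyEq.rfl
    filter_upwards [h.row_eq hu] with ε e
    rw [if_pos hi, e k, hik, h.weight_le k le_rfl]
    ring
  · have hik : Fin.castLE k.isLt i < k := Fin.lt_def.2 (Fin.val_lt_last hi)
    simp only [if_neg hi, sub_zero]
    exact (isBigO_refl _ _).mul ((h.row_isBigO hu hik).sub htail)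

/-- Cramer's rule: pair the first `k + 1` rows of the eigenvector equation with the last row of the
adjugate, then replace both determinants by their values at `0`. Nothing is inverted, so either
minor may vanish. -/
theorem det_relation (h : IsGraded M B lam w k)
    (hu : ∀ᶠ ε in 𝓝[>] (0 : ℝ), u ε ⬝ᵥ u ε = 1 ∧ M ε *ᵥ u ε = lam ε k • u ε) :
    (fun ε => (leading (B 0) (k + 1) k.isLt).det * (ε ^ (2 * (k : ℕ)) * u ε k)
      - (leading (B 0) k k.isLt.le).det * (lam ε k * u ε k)) =O[𝓝[>] 0]
      fun ε => ε ^ (2 * (k : ℕ) + 1) := by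
  have hu1 := isBigO_one_of_unit (hu.mono fun _ h => h.1) k
  set T : ℝ → Matrix (Fin (k + 1)) (Fin (k + 1)) ℝ := fun ε => leading (B ε) (k + 1) k.isLt with hT
  have hTc : ContinuousAt T 0 := h.continuousAt_leading _ k.isLt
  have hadj : ∀ j, (fun ε => (T ε).adjugate (Fin.last k) j) =O[𝓝[>] 0] fun _ => (1 : ℝ) := fun j =>
    ((((continuous_id.matrix_adjugate).matrix_elem (Fin.last (k : ℕ)) j).continuousAt.comp
      hTc).tendsto.mono_left nhdsWithin_le_nhds).isBigO_one ℝ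
  -- Only this cofactor meets the term `λ_k u_k`, which sits in the last row.
  have hlast : ∀ ε, (T ε).adjugate (Fin.last k) (Fin.last k) = (leading (B ε) k k.isLt.le).det := by
    intro ε
    rw [adjugate_fin_succ_eq_det_submatrix, Even.neg_one_pow ⟨_, rfl⟩, one_mul]
    congr 1
    ext i j
    simp [hT, leading]
  have h1 : (fun ε => ∑ i, (T ε).adjugate (Fin.last k) i * (ε ^ (k : ℕ) * (T ε *ᵥ
        fun j => ε ^ (j : ℕ) * u ε (Fin.castLE k.isLt j)) i
      - if i = Fin.last k then lam ε k * u ε k else 0)) =O[𝓝[>] 0]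
      fun ε => 1 * ε ^ (2 * (k : ℕ) + 1) :=
    IsBigO.fun_sum fun i _ => (hadj i).mul (h.leading_row_isBigO hu i)
  have h2 : ∀ ε, ∑ i, (T ε).adjugate (Fin.last k) i * (ε ^ (k : ℕ) * (T ε *ᵥ
        fun j => ε ^ (j : ℕ) * u ε (Fin.castLE k.isLt j)) i
      - if i = Fin.last k then lam ε k * u ε k else 0)
      = (T ε).det * (ε ^ (2 * (k : ℕ)) * u ε k)
        - (leading (B ε) k k.isLt.le).det * (lam ε k * u ε k) := by
    intro ε
    simp only [mul_sub, Finset.sum_sub_distrib, mul_ite, mul_zero, Finset.sum_ite_eq',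
      Finset.mem_univ, if_true, hlast]
    congr 1
    have h3 := congrFun (show (T ε).adjugate *ᵥ (T ε *ᵥ
        fun j => ε ^ (j : ℕ) * u ε (Fin.castLE k.isLt j)) = (T ε).det •
        fun j : Fin (k + 1) => ε ^ (j : ℕ) * u ε (Fin.castLE k.isLt j) by
      rw [mulVec_mulVec, adjugate_mul, smul_mulVec, one_mulVec]) (Fin.last k)
    rw [mulVec, dotProduct, Pi.smul_apply, smul_eq_mul] at h3
    have h4 : Fin.castLE k.isLt (Fin.last (k : ℕ)) = k := rfl
    rw [Fin.val_last, h4] at h3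
    calc _ = ε ^ (k : ℕ) * ∑ i, (T ε).adjugate (Fin.last k) i * (T ε *ᵥ
        fun j => ε ^ (j : ℕ) * u ε (Fin.castLE k.isLt j)) i := by
          rw [Finset.mul_sum]; exact Finset.sum_congr rfl fun i _ => by ring
      _ = _ := by rw [h3, two_mul, pow_add]; ring
  simp only [h2, one_mul] at h1
  have h5 : (fun ε => ((T ε).det - (T 0).det) * (ε ^ (2 * (k : ℕ)) * u ε k)) =O[𝓝[>] 0]
      fun ε => ε ^ 1 * (ε ^ (2 * (k : ℕ)) * 1) :=
    (h.det_sub_isBigO _ k.isLt).mul ((isBigO_refl _ _).mul hu1)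
  have h6 : (fun ε => ((leading (B ε) k k.isLt.le).det - (leading (B 0) k k.isLt.le).det)
      * (lam ε k * u ε k)) =O[𝓝[>] 0] fun ε => ε ^ 1 * (ε ^ (2 * (k : ℕ)) * 1) :=
    (h.det_sub_isBigO _ k.isLt.le).mul (h.eigenvalue_isBigO.mul hu1)
  have hpow : ∀ ε : ℝ, ε ^ 1 * (ε ^ (2 * (k : ℕ)) * 1) = ε ^ (2 * (k : ℕ) + 1) := fun ε => by ring
  simp only [hpow] at h5 h6
  refine ((h1.sub h5).add h6).congr_left fun ε => ?_
  ring

/-- A lower bound on `λ_k` is needed only to cancel it in `λ_k u_i` for `i > k`; for the last index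
there are no such coordinates. -/
theorem eigenvector_isBigO (h : IsGraded M B lam w k)
    (hu : ∀ᶠ ε in 𝓝[>] (0 : ℝ), u ε ⬝ᵥ u ε = 1 ∧ M ε *ᵥ u ε = lam ε k • u ε)
    (hdet : (leading (B 0) k k.isLt.le).det ≠ 0)
    (hdet' : (leading (B 0) (k + 1) k.isLt).det ≠ 0 ∨ (k : ℕ) + 1 = n) {i : Fin n} (hi : i ≠ k) :
    (fun ε => u ε i) =O[𝓝[>] 0] fun ε => ε ^ 1 := by
  rcases hdet' with hdet' | hn
  · refine isBigO_of_pow_mul (p := 2 * (k : ℕ)) ?_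
    simp only [← pow_add]
    exact ((h.isBigO_eigenvalue hdet').mul (isBigO_refl _ _)).trans
      (h.eigenvalue_mul_isBigO hu hdet hi)
  · exact h.eigenvector_isBigO_of_lt hu hdet
      (lt_of_le_of_ne (Fin.le_def.2 (by have := i.isLt; omega)) hi)

end Eigenvector

theorem exists_eigenvector (h : IsGraded M B lam w k) : ∃ u : ℝ → Fin n → ℝ,
    ∀ᶠ ε in 𝓝[>] (0 : ℝ), u ε ⬝ᵥ u ε = 1 ∧ M ε *ᵥ u ε = lam ε k • u ε := by
  have hex : ∀ ε, ∃ v : Fin n → ℝ, HasOrderedSpectrum (M ε) (lam ε) →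
      v ⬝ᵥ v = 1 ∧ M ε *ᵥ v = lam ε k • v := by
    intro ε
    by_cases hs : HasOrderedSpectrum (M ε) (lam ε)
    · obtain ⟨-, U, hU, hMU⟩ := hs
      refine ⟨U *ᵥ Pi.single k 1, fun _ => ⟨?_, ?_⟩⟩
      · rw [dotProduct_mulVec_mulVec, hU]
        simp
      · rw [mulVec_mulVec, hMU, ← mulVec_mulVec, ← mulVec_smul]
        congr 1
        ext i
        rw [mulVec_diagonal]
        by_cases hik : i = k
        · subst hik; simp
        · simp [hik]
    · exact ⟨0, fun h' => absurd h' hs⟩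
  choose u hu using hex
  exact ⟨u, h.spectrum.mono fun ε => hu ε⟩

theorem hasMainTerm (h : IsGraded M B lam w k) (hdet : (leading (B 0) k k.isLt.le).det ≠ 0) :
    HasMainTerm (𝓝[>] 0) (fun ε => lam ε k) (2 * (k : ℕ))
      ((leading (B 0) (k + 1) k.isLt).det / (leading (B 0) k k.isLt.le).det) := by
  obtain ⟨u, hu⟩ := h.exists_eigenvector
  have hu1 := hu.mono fun _ h => h.1
  set d := (leading (B 0) k k.isLt.le).det
  set d' := (leading (B 0) (k + 1) k.isLt).det with hd'
  -- For `i = k` this is `det_relation` divided by `-d`. For `i ≠ k`, either `d' = 0` and there is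
  -- nothing to subtract, or `d' ≠ 0` and `u_i = O(ε)`.
  refine isBigO_of_unit hu1 (fun i => ?_) (isBigO_one_of_unit hu1)
  by_cases hi : i = k
  · subst hi
    refine ((h.det_relation hu).const_mul_left (-d⁻¹)).congr_left fun ε => ?_
    field_simp
    ring
  · have h1 := h.eigenvalue_mul_isBigO hu hdet hi
    by_cases hz : d' = 0
    · simpa [hz] using h1
    · have h2 := ((isBigO_refl (fun ε : ℝ => ε ^ (2 * (k : ℕ))) (𝓝[>] 0)).mul
        (h.eigenvector_isBigO hu hdet (Or.inl hz) hi)).const_mul_left (d' / d)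
      simp only [← pow_add] at h2
      refine (h1.sub h2).congr_left fun ε => ?_
      ring

end IsGraded

end FlatLimit

namespace FlatLimit

/-! ### From graded matrices to main terms and limiting eigenvectors -/

theorem IsAnalyticEVD.exists_eigenbasis {n : ℕ} {A : ℝ → Matrix (Fin n) (Fin n) ℝ}
    {lam : Fin n → ℝ → ℝ} {P : Fin n → ℝ → Matrix (Fin n) (Fin n) ℝ} (h : IsAnalyticEVD A lam P) :
    ∃ U : ℝ → Matrix (Fin n) (Fin n) ℝ, ∀ᶠ ε in 𝓝[>] (0 : ℝ),
      HasOrderedSpectrum (A ε) (fun k => lam k ε) ∧ (U ε)ᵀ * U ε = 1 ∧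
      A ε * U ε = U ε * diagonal (fun k => lam k ε) ∧
      ∀ k, P k ε = vecMulVec (fun i => U ε i k) fun i => U ε i k := by
  have hev : ∀ᶠ ε in 𝓝[>] (0 : ℝ), ∃ U : Matrix (Fin n) (Fin n) ℝ,
      HasOrderedSpectrum (A ε) (fun k => lam k ε) ∧ Uᵀ * U = 1 ∧
      A ε * U = U * diagonal (fun k => lam k ε) ∧
      ∀ k, P k ε = vecMulVec (fun i => U i k) fun i => U i k := by
    filter_upwards [h.symm.filter_mono nhdsWithin_le_nhds, h.orth.filter_mono nhdsWithin_le_nhds,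
      h.rank_one.filter_mono nhdsWithin_le_nhds, h.sum_eq.filter_mono nhdsWithin_le_nhds,
      h.ordered] with ε h1 h2 h3 h4 h5
    obtain ⟨U, hU, hAU, hP⟩ := exists_orthonormal_of_projectors h1 h2 h3 h4
    exact ⟨U, ⟨h5, U, hU, hAU⟩, hU, hAU, hP⟩
  exact hev.choice

theorem isEigenvalueMainTerm_of_isGraded {n : ℕ} {A B : ℝ → Matrix (Fin n) (Fin n) ℝ}
    {Q : Matrix (Fin n) (Fin n) ℝ} {w : Fin n → ℕ} {k : Fin n}
    (hgr : ∀ lam : ℝ → Fin n → ℝ, (∀ᶠ ε in 𝓝[>] (0 : ℝ), HasOrderedSpectrum (A ε) (lam ε)) →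
      IsGraded (fun ε => Qᵀ * A ε * Q) B lam w k)
    (hsymm : ∀ᶠ ε in 𝓝[>] (0 : ℝ), (A ε).IsHermitian)
    (hdet : (leading (B 0) k k.isLt.le).det ≠ 0) :
    IsEigenvalueMainTerm A k
      ((leading (B 0) (k + 1) k.isLt).det / (leading (B 0) k k.isLt.le).det) := by
  refine ⟨(hgr (fun ε => sortedEigenvalue (A ε))
    (hsymm.mono fun ε => hasOrderedSpectrum_sortedEigenvalue)).hasMainTerm hdet, ?_⟩
  intro lam P hEVD
  obtain ⟨U, hU⟩ := hEVD.exists_eigenbasis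
  have h1 := (hgr (fun ε k => lam k ε) (hU.mono fun ε h => h.1)).hasMainTerm hdet
  refine isBigO_nhds_of_isBigO_right ?_ h1
  exact (hEVD.analytic_lam k).sub ((analyticAt_id.pow _).mul analyticAt_const)

/-- In the basis `Q` all coordinates but the `k`-th tend to zero, so the square of the `k`-th tends
to `1`. Its sign may vary with `ε`, but products of coordinates converge. -/
theorem tendsto_vecMulVec_of_isBigO {n : ℕ} {Q : Matrix (Fin n) (Fin n) ℝ} (hQ : Qᵀ * Q = 1)
    {u : ℝ → Fin n → ℝ} {k : Fin n} (hu : ∀ᶠ ε in 𝓝[>] (0 : ℝ), u ε ⬝ᵥ u ε = 1)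
    (h : ∀ i ≠ k, (fun ε => (Qᵀ *ᵥ u ε) i) =O[𝓝[>] 0] fun ε => ε ^ 1) :
    Tendsto (fun ε => vecMulVec (u ε) (u ε)) (𝓝[>] 0)
      (𝓝 (vecMulVec (fun i => Q i k) fun i => Q i k)) := by
  set v : ℝ → Fin n → ℝ := fun ε => Qᵀ *ᵥ u ε with hv
  have hQ' : Q * Qᵀ = 1 := mul_eq_one_comm.1 hQ
  have hvv : ∀ᶠ ε in 𝓝[>] (0 : ℝ), v ε ⬝ᵥ v ε = 1 := by
    filter_upwards [hu] with ε hε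
    rw [hv, dotProduct_mulVec_mulVec, transpose_transpose, hQ', one_mulVec, hε]
  have hv1 := isBigO_one_of_unit hvv
  have ht0 : Tendsto (fun ε : ℝ => ε ^ 1) (𝓝[>] 0) (𝓝 0) := by
    simp only [pow_one]
    exact tendsto_id.mono_left nhdsWithin_le_nhds
  have hlim0 : ∀ i ≠ k, ∀ j, Tendsto (fun ε => v ε i * v ε j) (𝓝[>] 0) (𝓝 0) := by
    intro i hi j
    refine IsBigO.trans_tendsto (g'' := fun ε : ℝ => ε ^ 1) ?_ ht0
    simpa using (h i hi).mul (hv1 j)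
  have hlim : ∀ i j, Tendsto (fun ε => v ε i * v ε j) (𝓝[>] 0)
      (𝓝 (if i = k then if j = k then 1 else 0 else 0)) := by
    intro i j
    by_cases hi : i = k
    · by_cases hj : j = k
      · rw [if_pos hi, if_pos hj, hi, hj]
        have h1 : Tendsto (fun ε => 1 - ∑ l ∈ Finset.univ.erase k, v ε l * v ε l) (𝓝[>] 0)
            (𝓝 (1 - ∑ l ∈ Finset.univ.erase k, 0)) :=
          tendsto_const_nhds.sub (tendsto_finsetSum _ fun l hl => hlim0 l (Finset.ne_of_mem_erase hl) l)
        rw [Finset.sum_const_zero, sub_zero] at h1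
        refine h1.congr' ?_
        filter_upwards [hvv] with ε hε
        rw [dotProduct, ← Finset.add_sum_erase _ _ (Finset.mem_univ k)] at hε
        linarith
      · rw [if_pos hi, if_neg hj]
        simpa [mul_comm] using hlim0 j hj i
    · rw [if_neg hi]
      exact hlim0 i hi j
  have huv : ∀ ε a, u ε a = ∑ i, Q a i * v ε i := by
    intro ε a
    have : Q *ᵥ v ε = u ε := by rw [hv, mulVec_mulVec, hQ', one_mulVec]
    rw [← congrFun this a]
    rfl
  refine tendsto_pi_nhds.2 fun a => tendsto_pi_nhds.2 fun b => ?_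
  have h2 : Tendsto (fun ε => ∑ i, ∑ j, Q a i * Q b j * (v ε i * v ε j)) (𝓝[>] 0)
      (𝓝 (∑ i, ∑ j, Q a i * Q b j * (if i = k then if j = k then 1 else 0 else 0))) :=
    tendsto_finsetSum _ fun i _ => tendsto_finsetSum _ fun j _ => (hlim i j).const_mul _
  have h3 : ∑ i, ∑ j, Q a i * Q b j * (if i = k then if j = k then (1 : ℝ) else 0 else 0)
      = vecMulVec (fun i => Q i k) (fun i => Q i k) a b := by
    rw [Finset.sum_eq_single k, Finset.sum_eq_single k]
    · simp [vecMulVec_apply]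
    · intro j _ hj; simp [hj]
    · simp
    · intro i _ hi; simp [hi]
    · simp
  rw [h3] at h2
  refine h2.congr fun ε => ?_
  rw [vecMulVec_apply, huv, huv, Finset.sum_mul_sum]
  exact Finset.sum_congr rfl fun i _ => Finset.sum_congr rfl fun j _ => by ring

theorem isLimitingEigenvector_of_isGraded {n : ℕ} {A B : ℝ → Matrix (Fin n) (Fin n) ℝ}
    {Q : Matrix (Fin n) (Fin n) ℝ} (hQ : Qᵀ * Q = 1) {w : Fin n → ℕ} {k : Fin n}
    (hgr : ∀ lam : ℝ → Fin n → ℝ, (∀ᶠ ε in 𝓝[>] (0 : ℝ), HasOrderedSpectrum (A ε) (lam ε)) →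
      IsGraded (fun ε => Qᵀ * A ε * Q) B lam w k)
    (hsymm : ∀ᶠ ε in 𝓝[>] (0 : ℝ), (A ε).IsHermitian)
    (hdet : (leading (B 0) k k.isLt.le).det ≠ 0)
    (hdet' : (leading (B 0) (k + 1) k.isLt).det ≠ 0 ∨ (k : ℕ) + 1 = n) :
    IsLimitingEigenvector A k fun i => Q i k := by
  have hQ' : Q * Qᵀ = 1 := mul_eq_one_comm.1 hQ
  have key : ∀ lam : ℝ → Fin n → ℝ,
      (∀ᶠ ε in 𝓝[>] (0 : ℝ), HasOrderedSpectrum (A ε) (lam ε)) → ∀ u : ℝ → Fin n → ℝ,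
      (∀ᶠ ε in 𝓝[>] (0 : ℝ), u ε ⬝ᵥ u ε = 1 ∧ A ε *ᵥ u ε = lam ε k • u ε) →
      Tendsto (fun ε => vecMulVec (u ε) (u ε)) (𝓝[>] 0)
        (𝓝 (vecMulVec (fun i => Q i k) fun i => Q i k)) := by
    intro lam hlam u hu
    refine tendsto_vecMulVec_of_isBigO hQ (hu.mono fun _ h => h.1) fun i hi => ?_
    refine (hgr lam hlam).eigenvector_isBigO (u := fun ε => Qᵀ *ᵥ u ε) ?_ hdet hdet' hi
    filter_upwards [hu] with ε hε
    constructor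
    · rw [dotProduct_mulVec_mulVec, transpose_transpose, hQ', one_mulVec, hε.1]
    · rw [mulVec_mulVec, Matrix.mul_assoc, hQ', Matrix.mul_one, ← mulVec_mulVec, hε.2, mulVec_smul]
  refine ⟨fun lam P hEVD => ?_, fun u hu => key _
    (hsymm.mono fun ε => hasOrderedSpectrum_sortedEigenvalue) u hu⟩
  obtain ⟨U, hU⟩ := hEVD.exists_eigenbasis
  have h1 := key (fun ε k => lam k ε) (hU.mono fun ε h => h.1) (fun ε i => U ε i k) (by
    filter_upwards [hU] with ε hε
    constructor
    · have := congrFun (congrFun hε.2.1 k) k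
      simpa [mul_apply, dotProduct] using this
    · ext i
      have := congrFun (congrFun hε.2.2.1 i) k
      rw [mul_diagonal] at this
      rw [Pi.smul_apply, smul_eq_mul, mul_comm, ← this]
      rfl)
  have h2 : Tendsto (fun ε => P k ε) (𝓝[>] 0) (𝓝 (P k 0)) :=
    tendsto_pi_nhds.2 fun i => tendsto_pi_nhds.2 fun j =>
      (hEVD.analytic_P k i j).continuousAt.tendsto.mono_left nhdsWithin_le_nhds
  refine tendsto_nhds_unique (h2.congr' ?_) h1
  filter_upwards [hU] with ε hε using hε.2.2.2 k

/-! ### The grading of scaled kernel matrices -/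

/-- With a QR factorization of only `s` columns, the later columns of `Q` are arbitrary but still
annihilate all degrees below `s`; hence the weights `min i s`. -/
theorem exists_grading {n s : ℕ} {a : ℝ} (ha : 0 < a) {K : ℝ → ℝ → ℝ} (hK : IsMixedCk K a n)
    {x : Fin n → ℝ} {A : ℝ → Matrix (Fin n) (Fin n) ℝ}
    (hA : ∀ i j, AnalyticAt ℝ (fun ε => A ε i j) 0)
    (hAK : ∀ᶠ ε in 𝓝[>] (0 : ℝ), A ε = kernelMatrix K x ε) (hs : s ≤ n)
    {Q : Matrix (Fin n) (Fin n) ℝ} {R : Matrix (Fin n) (Fin s) ℝ}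
    (h : IsFullQR (vander x s) Q R) :
    ∃ B : ℝ → Matrix (Fin n) (Fin n) ℝ, (∀ i j, AnalyticAt ℝ (fun ε => B ε i j) 0) ∧
      (∀ᶠ ε in 𝓝[>] (0 : ℝ), ∀ i j, (Qᵀ * A ε * Q) i j
        = ε ^ (min (i : ℕ) s + min (j : ℕ) s) * B ε i j) ∧
      ∀ i j : Fin s, B 0 (Fin.castLE hs i) (Fin.castLE hs j)
        = R (Fin.castLE hs i) i * R (Fin.castLE hs j) j * wronskian K s i j := by
  have hR : ∀ (i : Fin n) (b : Fin s), ∑ l, Q l i * x l ^ (b : ℕ) = R i b := by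
    intro i b
    rw [← h.transpose_mul]
    simp [mul_apply, vander]
  have hQ0 : ∀ (i : Fin n), ∀ b < min (i : ℕ) s, ∑ l, Q l i * x l ^ b = 0 := by
    intro i b hb
    rw [hR i ⟨b, by omega⟩]
    exact h.upper i _ (by simp; omega)
  have hentry : ∀ ε i j, (Qᵀ * A ε * Q) i j = ∑ l, ∑ m, Q l i * Q m j * A ε l m := by
    intro ε i j
    simp only [mul_apply, transpose_apply, Finset.sum_mul]
    rw [Finset.sum_comm]
    exact Finset.sum_congr rfl fun l _ => Finset.sum_congr rfl fun m _ => by ring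
  have hfac : ∀ i j : Fin n, ∃ g : ℝ → ℝ, AnalyticAt ℝ g 0 ∧
      (∀ᶠ ε in 𝓝 (0 : ℝ), (Qᵀ * A ε * Q) i j = ε ^ (min (i : ℕ) s + min (j : ℕ) s) * g ε) ∧
      g 0 = (∑ l, Q l i * x l ^ min (i : ℕ) s) * (∑ l, Q l j * x l ^ min (j : ℕ) s) *
        (pderiv K (min (i : ℕ) s) (min (j : ℕ) s) 0 0
          / (((min (i : ℕ) s).factorial : ℝ) * ((min (j : ℕ) s).factorial : ℝ))) := by
    intro i j
    refine exists_analytic_factor_of_tendsto ?_ ?_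
    · simp only [hentry]
      exact Finset.analyticAt_fun_sum _ fun l _ => Finset.analyticAt_fun_sum _ fun m _ =>
        analyticAt_const.mul (hA l m)
    · refine (tendsto_kernel_form ha hK (by omega) (by omega) (hQ0 i) (hQ0 j)).congr' ?_
      filter_upwards [hAK] with ε hε
      rw [hentry, hε]
      rfl
  choose B hB1 hB2 hB3 using hfac
  refine ⟨fun ε => Matrix.of fun i j => B i j ε, hB1, ?_, fun i j => ?_⟩
  · exact (eventually_all.2 fun i => eventually_all.2 fun j => hB2 i j).filter_mono
      nhdsWithin_le_nhds
  · change B _ _ 0 = _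
    rw [hB3]
    have h1 : ∀ i : Fin s, min ((Fin.castLE hs i : Fin n) : ℕ) s = i := fun i => by simp
    rw [h1, h1, hR, hR]
    rfl

/-- For `ε > 0` the block is congruent, through `diag(ε^(-i))`, to a principal submatrix of `Qᵀ A(ε)
Q`; semidefiniteness survives the limit. -/
theorem posSemidef_leading_of_grading {n s : ℕ} {A B : ℝ → Matrix (Fin n) (Fin n) ℝ}
    {Q : Matrix (Fin n) (Fin n) ℝ} (hs : s ≤ n)
    (hB : ∀ i j, AnalyticAt ℝ (fun ε => B ε i j) 0)
    (hAB : ∀ᶠ ε in 𝓝[>] (0 : ℝ), ∀ i j, (Qᵀ * A ε * Q) i j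
        = ε ^ (min (i : ℕ) s + min (j : ℕ) s) * B ε i j)
    (hpsd : ∀ᶠ ε in 𝓝[>] (0 : ℝ), (A ε).PosSemidef) : (leading (B 0) s hs).PosSemidef := by
  have hev : ∀ᶠ ε in 𝓝[>] (0 : ℝ), (leading (B ε) s hs).PosSemidef := by
    filter_upwards [hAB, hpsd, self_mem_nhdsWithin] with ε h1 h2 h3
    have hε : ε ≠ 0 := ne_of_gt h3
    have h4 := ((h2.conjTranspose_mul_mul_same Q).submatrix
      (Fin.castLE hs)).conjTranspose_mul_mul_same (diagonal fun i : Fin s => (ε ^ (i : ℕ))⁻¹)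
    convert h4 using 1
    ext i j
    rw [conjTranspose_eq_transpose_of_trivial, conjTranspose_eq_transpose_of_trivial,
      diagonal_transpose, mul_diagonal, diagonal_mul, submatrix_apply, h1]
    simp only [leading, submatrix_apply, Fin.val_castLE, min_eq_left i.isLt.le,
      min_eq_left j.isLt.le, pow_add]
    field_simp
  have hlim : Tendsto (fun ε => leading (B ε) s hs) (𝓝[>] 0) (𝓝 (leading (B 0) s hs)) :=
    tendsto_pi_nhds.2 fun i => tendsto_pi_nhds.2 fun j =>
      (hB _ _).continuousAt.tendsto.mono_left nhdsWithin_le_nhds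
  have hcoord : ∀ i j, Tendsto (fun ε => leading (B ε) s hs i j) (𝓝[>] 0)
      (𝓝 (leading (B 0) s hs i j)) := fun i j => tendsto_pi_nhds.1 (tendsto_pi_nhds.1 hlim i) j
  refine PosSemidef.of_dotProduct_mulVec_nonneg ?_ fun v => ?_
  · ext i j
    rw [conjTranspose_apply, star_trivial]
    refine tendsto_nhds_unique (hcoord j i) ((hcoord i j).congr' ?_)
    filter_upwards [hev] with ε hε
    simpa using (hε.isHermitian.apply i j).symm
  · refine ge_of_tendsto (f := fun ε => star v ⬝ᵥ (leading (B ε) s hs *ᵥ v)) ?_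
      (hev.mono fun ε hε => hε.dotProduct_mulVec_nonneg v)
    simp only [mulVec, dotProduct]
    exact tendsto_finsetSum _ fun i _ => tendsto_const_nhds.mul
      (tendsto_finsetSum _ fun j _ => (hcoord i j).mul tendsto_const_nhds)

theorem det_leading_of_entries {n s : ℕ} {K : ℝ → ℝ → ℝ} {B : Matrix (Fin n) (Fin n) ℝ}
    {R : Matrix (Fin n) (Fin s) ℝ} (hs : s ≤ n)
    (hB : ∀ i j : Fin s, B (Fin.castLE hs i) (Fin.castLE hs j)
        = R (Fin.castLE hs i) i * R (Fin.castLE hs j) j * wronskian K s i j) {m : ℕ} (hm : m ≤ s) :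
    (leading B m (hm.trans hs)).det =
      (∏ i : Fin m, R (Fin.castLE (hm.trans hs) i) (Fin.castLE hm i) ^ 2)
        * (wronskian K m).det := by
  have h1 : leading B m (hm.trans hs)
      = diagonal (fun i : Fin m => R (Fin.castLE (hm.trans hs) i) (Fin.castLE hm i))
        * wronskian K m
        * diagonal (fun i : Fin m => R (Fin.castLE (hm.trans hs) i) (Fin.castLE hm i)) := by
    ext i j
    rw [mul_diagonal, diagonal_mul]
    have := hB (Fin.castLE hm i) (Fin.castLE hm j)
    simp only [Fin.castLE_castLE] at this
    rw [leading, submatrix_apply, this]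
    simp only [wronskian, of_apply, Fin.val_castLE]
    ring
  rw [h1, det_mul, det_mul, det_diagonal, Finset.prod_pow]
  ring

/-- The data of a kernel with its points and an analytic matrix function that extends the scaled
kernel matrices. -/
structure IsKernelFamily {n : ℕ} (K : ℝ → ℝ → ℝ) (x : Fin n → ℝ)
    (A : ℝ → Matrix (Fin n) (Fin n) ℝ) : Prop where
  injective : Function.Injective x
  exists_mixedCk : ∃ a > 0, IsMixedCk K a n
  analytic : ∀ i j, AnalyticAt ℝ (fun ε => A ε i j) 0
  eq : ∀ᶠ ε in 𝓝[>] (0 : ℝ), A ε = kernelMatrix K x ε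
  posSemidef : ∀ᶠ ε in 𝓝[>] (0 : ℝ), (A ε).PosSemidef

namespace IsKernelFamily

variable {n : ℕ} {K : ℝ → ℝ → ℝ} {x : Fin n → ℝ} {A : ℝ → Matrix (Fin n) (Fin n) ℝ}

theorem exists_isGraded (h : IsKernelFamily K x A) {s : ℕ} (hs : s ≤ n)
    {Q : Matrix (Fin n) (Fin n) ℝ} {R : Matrix (Fin n) (Fin s) ℝ}
    (hQR : IsFullQR (vander x s) Q R) :
    ∃ B : ℝ → Matrix (Fin n) (Fin n) ℝ, (leading (B 0) s hs).PosSemidef ∧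
      (∀ m (hm : m ≤ s), (leading (B 0) m (hm.trans hs)).det
        = ((vander x m)ᵀ * vander x m).det * (wronskian K m).det) ∧
      ∀ k : Fin n, (k : ℕ) < s → ∀ lam : ℝ → Fin n → ℝ,
        (∀ᶠ ε in 𝓝[>] (0 : ℝ), HasOrderedSpectrum (A ε) (lam ε)) →
        IsGraded (fun ε => Qᵀ * A ε * Q) B lam (fun i => min (i : ℕ) s) k := by
  obtain ⟨a, ha, hK⟩ := h.exists_mixedCk
  obtain ⟨B, hB1, hB2, hB3⟩ := exists_grading ha hK h.analytic h.eq hs hQR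
  refine ⟨B, posSemidef_leading_of_grading hs hB1 hB2 h.posSemidef, fun m hm => ?_,
    fun k hk lam hlam => ⟨fun i hi => ?_, fun i hi => ?_, hB1, hB2, ?_, ?_⟩⟩
  · rw [det_leading_of_entries hs hB3 hm, hQR.det_gram hs hm]
  · have := Fin.le_def.1 hi
    omega
  · have := Fin.lt_def.1 hi
    omega
  · exact hlam.mono fun ε hε => hε.conj hQR.orth
  · filter_upwards [hlam, h.posSemidef] with ε h1 h2 m using h1.nonneg h2 m

theorem det_gram_ne_zero (h : IsKernelFamily K x A) {m : ℕ} (hm : m ≤ n) :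
    ((vander x m)ᵀ * vander x m).det ≠ 0 := by
  obtain ⟨Q, R, hQR⟩ := exists_isFullQR (vander x n)
  rw [hQR.det_gram le_rfl hm]
  exact Finset.prod_ne_zero_iff.2 fun i _ => pow_ne_zero _
    (hQR.exists_polynomial le_rfl h.injective i (i.isLt.trans_le hm)).1

/-- A nonsingular positive semidefinite leading block is positive definite, so its own leading
minors are positive. This supplies the nonvanishing for all smaller indices. -/
theorem det_wronskian_ne_zero (h : IsKernelFamily K x A) {m s : ℕ} (hm : m ≤ s) (hs : s ≤ n)
    (hdet : (wronskian K s).det ≠ 0) : (wronskian K m).det ≠ 0 := by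
  obtain ⟨Q, R, hQR⟩ := exists_isFullQR (vander x n)
  obtain ⟨B, hB1, hB2, -⟩ := h.exists_isGraded le_rfl hQR
  have hpsd : (leading (B 0) s hs).PosSemidef := hB1.submatrix (Fin.castLE hs)
  have hne : (leading (B 0) s hs).det ≠ 0 := by
    rw [hB2 s hs]
    exact mul_ne_zero (h.det_gram_ne_zero hs) hdet
  have hpos := ((hpsd.posDef_iff_det_ne_zero.2 hne).submatrix (Fin.castLE_injective hm)).det_pos
  have h1 : (leading (B 0) s hs).submatrix (Fin.castLE hm) (Fin.castLE hm)
      = leading (B 0) m (hm.trans hs) := rfl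
  rw [h1, hB2 m (hm.trans hs)] at hpos
  exact right_ne_zero_of_mul hpos.ne'

theorem isHermitian (h : IsKernelFamily K x A) : ∀ᶠ ε in 𝓝[>] (0 : ℝ), (A ε).IsHermitian :=
  h.posSemidef.mono fun _ h => h.isHermitian

theorem isEigenvalueMainTerm (h : IsKernelFamily K x A) (k : Fin n)
    (hdet : (wronskian K k).det ≠ 0) :
    IsEigenvalueMainTerm A k
      (((vander x (k + 1))ᵀ * vander x (k + 1)).det / ((vander x k)ᵀ * vander x k).det
        * ((wronskian K (k + 1)).det / (wronskian K k).det)) := by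
  obtain ⟨Q, R, hQR⟩ := exists_isFullQR (vander x n)
  obtain ⟨B, -, hB2, hB3⟩ := h.exists_isGraded le_rfl hQR
  have h1 := isEigenvalueMainTerm_of_isGraded (hB3 k k.isLt) h.isHermitian (by
    rw [hB2 k k.isLt.le]
    exact mul_ne_zero (h.det_gram_ne_zero k.isLt.le) hdet)
  rwa [hB2 (k + 1) k.isLt, hB2 k k.isLt.le, mul_div_mul_comm] at h1

theorem isLimitingEigenvector (h : IsKernelFamily K x A) {s : ℕ} (hs : s ≤ n)
    {Q : Matrix (Fin n) (Fin n) ℝ} {R : Matrix (Fin n) (Fin s) ℝ}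
    (hQR : IsFullQR (vander x s) Q R) (k : Fin n) (hk : (k : ℕ) < s)
    (hdet : (wronskian K k).det ≠ 0) (hdet' : (wronskian K (k + 1)).det ≠ 0 ∨ (k : ℕ) + 1 = n) :
    IsLimitingEigenvector A k fun i => Q i k := by
  obtain ⟨B, -, hB2, hB3⟩ := h.exists_isGraded hs hQR
  refine isLimitingEigenvector_of_isGraded hQR.orth (hB3 k hk) h.isHermitian ?_ (hdet'.imp_left ?_)
  · rw [hB2 k hk.le]
    exact mul_ne_zero (h.det_gram_ne_zero k.isLt.le) hdet
  · intro hd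
    rw [hB2 (k + 1) hk]
    exact mul_ne_zero (h.det_gram_ne_zero k.isLt) hd

end IsKernelFamily

end FlatLimit

theorem mainTheorem3 {n : ℕ} (a : ℝ) (ha : 0 < a) (K : ℝ → ℝ → ℝ)
    (hK : FlatLimit.IsMixedCk K a n)
    (x : Fin n → ℝ) (hx : Function.Injective x)
    (ε₀ : ℝ) (hε₀ : 0 < ε₀) (hxΩ : ∀ i, ε₀ * x i ∈ Set.Ioo (-a) a)
    (hpsd : ∀ ε ∈ Set.Icc 0 ε₀, (FlatLimit.kernelMatrix K x ε).PosSemidef)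
    -- `A` is the analytic matrix function that agrees with `K_ε` for `0 ≤ ε ≤ ε₀`
    (A : ℝ → Matrix (Fin n) (Fin n) ℝ)
    (hA : ∀ i j, AnalyticAt ℝ (fun ε => A ε i j) 0)
    (hAK : ∀ ε ∈ Set.Icc 0 ε₀, A ε = FlatLimit.kernelMatrix K x ε) :
    -- part 1, with `k = s - 1`
    (∀ k : Fin n, (FlatLimit.wronskian K k).det ≠ 0 →
      FlatLimit.IsEigenvalueMainTerm A k
        (((FlatLimit.vander x (k + 1))ᵀ * FlatLimit.vander x (k + 1)).det
            / ((FlatLimit.vander x k)ᵀ * FlatLimit.vander x k).det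
          * ((FlatLimit.wronskian K (k + 1)).det / (FlatLimit.wronskian K k).det))) ∧
    -- part 2
    (∀ s : ℕ, 1 ≤ s → s < n → (FlatLimit.wronskian K s).det ≠ 0 →
      ∀ (Q : Matrix (Fin n) (Fin n) ℝ) (R : Matrix (Fin n) (Fin s) ℝ),
        FlatLimit.IsFullQR (FlatLimit.vander x s) Q R →
        (∀ k : Fin n, (k : ℕ) < s → FlatLimit.IsLimitingEigenvector A k (fun i => Q i k)) ∧
        ∃ φ : ℕ → Polynomial ℝ, FlatLimit.IsDiscreteOrthonormal x s φ ∧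
          ∀ k : Fin n, (k : ℕ) < s → ∀ i, Q i k = (φ k).eval (x i)) ∧
    -- part 3
    ((FlatLimit.wronskian K (n - 1)).det ≠ 0 →
      (∀ k : Fin n, FlatLimit.IsEigenvalueMainTerm A k
        (((FlatLimit.vander x (k + 1))ᵀ * FlatLimit.vander x (k + 1)).det
            / ((FlatLimit.vander x k)ᵀ * FlatLimit.vander x k).det
          * ((FlatLimit.wronskian K (k + 1)).det / (FlatLimit.wronskian K k).det))) ∧
      ∀ (Q R : Matrix (Fin n) (Fin n) ℝ), FlatLimit.IsFullQR (FlatLimit.vander x n) Q R →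
        (∀ k : Fin n, FlatLimit.IsLimitingEigenvector A k (fun i => Q i k)) ∧
        ∃ φ : ℕ → Polynomial ℝ, FlatLimit.IsDiscreteOrthonormal x n φ ∧
          ∀ k : Fin n, ∀ i, Q i k = (φ k).eval (x i)) := by
  have hpos : ∀ᶠ ε in 𝓝[>] (0 : ℝ), ε ∈ Set.Icc 0 ε₀ := by
    filter_upwards [self_mem_nhdsWithin, nhdsWithin_le_nhds (gt_mem_nhds hε₀)] with ε h1 h2
    exact ⟨le_of_lt h1, le_of_lt h2⟩
  have hfam : FlatLimit.IsKernelFamily K x A :=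
    ⟨hx, ⟨a, ha, hK⟩, hA, hpos.mono fun ε hε => hAK ε hε,
      hpos.mono fun ε hε => by rw [hAK ε hε]; exact hpsd ε hε⟩
  refine ⟨fun k hk => hfam.isEigenvalueMainTerm k hk, fun s _ hs hdet Q R hQR => ⟨fun k hk => ?_,
    hQR.exists_isDiscreteOrthonormal hs.le hx⟩, fun hdet => ⟨fun k => ?_, fun Q R hQR =>
    ⟨fun k => ?_, ?_⟩⟩⟩
  · exact hfam.isLimitingEigenvector hs.le hQR k hk (hfam.det_wronskian_ne_zero hk.le hs.le hdet)
      (Or.inl (hfam.det_wronskian_ne_zero hk hs.le hdet))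
  · exact hfam.isEigenvalueMainTerm k
      (hfam.det_wronskian_ne_zero (Nat.le_sub_one_of_lt k.isLt) (Nat.sub_le n 1) hdet)
  · refine hfam.isLimitingEigenvector le_rfl hQR k k.isLt
      (hfam.det_wronskian_ne_zero (Nat.le_sub_one_of_lt k.isLt) (Nat.sub_le n 1) hdet) ?_
    -- The full Wronskian of order `n` may be singular, which is why the last eigenvector needs the
    -- separate alternative.
    by_cases hk : (k : ℕ) + 1 = n
    · exact Or.inr hk
    · exact Or.inl (hfam.det_wronskian_ne_zero (by have := k.isLt; omega) (Nat.sub_le n 1) hdet)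
  · obtain ⟨φ, h1, h2⟩ := hQR.exists_isDiscreteOrthonormal le_rfl hx
    exact ⟨φ, h1, fun k => h2 k k.isLt⟩
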